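/- **Theorem 3 (Non-extremal, vacuum isolated null surface).** Let $n>2$. A *space-time* is a smooth $n$-dimensional manifold with a smooth metric tensor $g$ of signature $(-,+,\dots,+)$ and Levi-Civita connection $\nabla$. A *null surface* is an embedded $(n-1)$-dimensional submanifold $\mathcal I$ on which the pullback $q$ of $g$ is degenerate at every point; it is *non-expanding* if at every point the trace of the bilinear form $(X,Y)\mapsto g(\nabla_X\ell,Y)$ over the quotient of the tangent space by the null direction vanishes for some (equivalently, every) tangent null vector field $\ell$ that is non-zero there. An *isolated null surface* $(\mathcal I,[\ell])$ is a non-expanding null surface, with induced covariant derivative $D_XY=\nabla_XY$ ($X,Y$ tangent to $\mathcal I$), together with a nowhere vanishing tangent null vector field $\ell$, taken up to a constant factor, such that $\mathcal L_\ell q=0$ and $[\mathcal L_\ell,D]=0$. Its *geometry* is the pair $(q,D)$; its *rotation 1-form potential* $\omega$ and its *surface gravity* $\kappa$ are defined by $D_a\ell^b=\omega_a\ell^b$ and $D_\ell\ell=\kappa\,\ell$. It is *non-extremal* if $\kappa\neq0$. The geometry of a non-extremal isolated null surface at which the vacuum Einstein equations $\mathrm{Ric}-\tfrac12Rg=-\Lambda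 g$ with cosmological constant $\Lambda$ hold is determined by $q$, $\omega$ and $\Lambda$. That is: let $\mathcal N$ be an $(n-1)$-dimensional manifold, and let $\iota_1:\mathcal N\to M_1$ and $\iota_2:\mathcal N\to M_2$ be embeddings onto non-extremal isolated null surfaces in two $n$-dimensional space-times, with null vector fields $\ell_1,\ell_2$ and induced covariant derivatives $D_1,D_2$ on $\mathcal N$. Suppose that the vacuum Einstein equations with the same cosmological constant $\Lambda$ hold at all points of both surfaces, that the two induced metric tensors on $\mathcal N$ coincide, and that the rotation 1-form potentials of $\ell_1$ and $\ell_2$ coincide. Then $D_1=D_2$. -/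

import Mathlib

open scoped Manifold ContDiff Topology

noncomputable section

namespace NullSurface

/-! ### Space-time: Lorentzian metric, Levi-Civita connection, curvature -/

section Spacetime

variable {n : ℕ} {M : Type*} [TopologicalSpace M] [ChartedSpace (EuclideanSpace ℝ (Fin n)) M]
  [IsManifold (𝓡 n) ∞ M]

/-- A vector field (not assumed to have any regularity). -/
abbrev VField (n : ℕ) (M : Type*) [TopologicalSpace M]
    [ChartedSpace (EuclideanSpace ℝ (Fin n)) M] : Type _ :=
  Π x : M, TangentSpace (𝓡 n) x

/-- The vector field `X` is smooth at the point `x`. -/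
def SmoothAt (X : VField n M) (x : M) : Prop :=
  ContMDiffAt (𝓡 n) (𝓡 n).tangent ∞
    (fun y => (⟨y, X y⟩ : TangentBundle (𝓡 n) M)) x

/-- The vector field `X` is differentiable at the point `x`. -/
def DiffAt (X : VField n M) (x : M) : Prop :=
  MDifferentiableAt (𝓡 n) (𝓡 n).tangent
    (fun y => (⟨y, X y⟩ : TangentBundle (𝓡 n) M)) x

/-- A connection in the tangent bundle of an `n`-dimensional manifold. The value `D Y x (X x)` is
`(D_X Y)(x)`. -/
abbrev Connection (n : ℕ) (M : Type*) [TopologicalSpace M]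
    [ChartedSpace (EuclideanSpace ℝ (Fin n)) M] [IsManifold (𝓡 n) ∞ M] : Type _ :=
  CovariantDerivative (𝓡 n) (EuclideanSpace ℝ (Fin n)) (TangentSpace (𝓡 n) : M → Type _)

/-- `D_X Y` as a vector field. -/
def Connection.along (D : Connection n M) (X Y : VField n M) : VField n M :=
  fun x => D Y x (X x)

/-- The connection `D` is smooth: `D_X Y` is smooth wherever `X` and `Y` are. -/
def Connection.IsSmooth (D : Connection n M) : Prop :=
  ∀ (x : M) (X Y : VField n M), SmoothAt X x → SmoothAt Y x → SmoothAt (D.along X Y) x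

/-- A smooth metric tensor of signature `(-,+,...,+)`. -/
structure LorentzMetric (n : ℕ) (M : Type*) [TopologicalSpace M]
    [ChartedSpace (EuclideanSpace ℝ (Fin n)) M] [IsManifold (𝓡 n) ∞ M] where
  /-- the bilinear form at each point -/
  val : Π x : M, TangentSpace (𝓡 n) x →L[ℝ] TangentSpace (𝓡 n) x →L[ℝ] ℝ
  symm : ∀ (x : M) (u v : TangentSpace (𝓡 n) x), val x u v = val x v u
  signature : ∀ x : M, ∃ t : TangentSpace (𝓡 n) x, val x t t < 0 ∧
    ∀ w : TangentSpace (𝓡 n) x, val x t w = 0 → w ≠ 0 → 0 < val x w w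
  smooth : ContMDiff (𝓡 n)
    ((𝓡 n).prod 𝓘(ℝ, EuclideanSpace ℝ (Fin n) →L[ℝ] EuclideanSpace ℝ (Fin n) →L[ℝ] ℝ)) ∞
    (fun x => Bundle.TotalSpace.mk'
      (EuclideanSpace ℝ (Fin n) →L[ℝ] EuclideanSpace ℝ (Fin n) →L[ℝ] ℝ) x (val x))

/-- `nabla` is the Levi-Civita connection of `g`: a smooth connection which is torsion free and
annihilates `g`. -/
structure IsLeviCivita (g : LorentzMetric n M) (nabla : Connection n M) : Prop where
  smooth : nabla.IsSmooth
  torsion_free : nabla.torsion = 0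
  metric : ∀ (x : M) (Y Z : VField n M), DiffAt Y x → DiffAt Z x →
    ∀ v : TangentSpace (𝓡 n) x,
      mvfderiv (𝓡 n) (fun y => g.val y (Y y) (Z y)) x v
        = g.val x (nabla Y x v) (Z x) + g.val x (Y x) (nabla Z x v)

/-- The curvature `R(X,Y)Z = D_X D_Y Z - D_Y D_X Z - D_[X,Y] Z`. -/
def curvature (D : Connection n M) (X Y Z : VField n M) : VField n M :=
  fun x => D (D.along Y Z) x (X x) - D (D.along X Z) x (Y x)
    - D Z x (VectorField.mlieBracket (𝓡 n) X Y x)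

/-- The curvature on tangent vectors at a point, evaluated through smooth local extensions. -/
def curvatureAt (D : Connection n M) (x : M) (u v w : TangentSpace (𝓡 n) x) :
    TangentSpace (𝓡 n) x :=
  curvature D (FiberBundle.extend (EuclideanSpace ℝ (Fin n)) u)
    (FiberBundle.extend (EuclideanSpace ℝ (Fin n)) v)
    (FiberBundle.extend (EuclideanSpace ℝ (Fin n)) w) x

/-- A basis of the tangent space at `x`, used to write traces. -/
def tangentBasis (x : M) : Module.Basis (Fin n) ℝ (TangentSpace (𝓡 n) x) :=
  (EuclideanSpace.basisFun (Fin n) ℝ).toBasis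

/-- The Ricci tensor `Ric(v,w)`, the trace of `u ↦ R(u,v)w`. -/
def ricci (D : Connection n M) (x : M) (v w : TangentSpace (𝓡 n) x) : ℝ :=
  ∑ i : Fin n, (tangentBasis x).repr (curvatureAt D x (tangentBasis x i) v w) i

/-- The scalar curvature `g^{ij} Ric_{ij}`. -/
def scalarCurvature (g : LorentzMetric n M) (nabla : Connection n M) (x : M) : ℝ :=
  ∑ i : Fin n, ∑ j : Fin n,
    (Matrix.of fun k l : Fin n => g.val x (tangentBasis x k) (tangentBasis x l))⁻¹ i j
      * ricci nabla x (tangentBasis x i) (tangentBasis x j)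

/-- The Einstein tensor `Ric - (1/2) R g`. -/
def einstein (g : LorentzMetric n M) (nabla : Connection n M) (x : M)
    (u v : TangentSpace (𝓡 n) x) : ℝ :=
  ricci nabla x u v - (1 / 2) * scalarCurvature g nabla x * g.val x u v

/-- The vacuum Einstein equations with cosmological constant `Λ` hold at all points of `S`. -/
def VacuumEinsteinOn (g : LorentzMetric n M) (nabla : Connection n M) (Λ : ℝ) (S : Set M) : Prop :=
  ∀ x ∈ S, ∀ u v : TangentSpace (𝓡 n) x, einstein g nabla x u v = -Λ * g.val x u v

end Spacetime

/-! ### Null surfaces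

`N` is an `(n-1)`-dimensional manifold, mapped by `ι` into the `n`-dimensional space-time `M`. -/

section Surface

variable {n : ℕ} {M : Type*} [TopologicalSpace M] [ChartedSpace (EuclideanSpace ℝ (Fin n)) M]
  [IsManifold (𝓡 n) ∞ M]
  {N : Type*} [TopologicalSpace N] [ChartedSpace (EuclideanSpace ℝ (Fin (n - 1))) N]
  [IsManifold (𝓡 (n - 1)) ∞ N]

/-- The pushforward of a tangent vector of the surface to the space-time. -/
abbrev push (ι : N → M) (p : N) : TangentSpace (𝓡 (n - 1)) p →L[ℝ] TangentSpace (𝓡 n) (ι p) :=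
  mfderiv (𝓡 (n - 1)) (𝓡 n) ι p

/-- The induced (degenerate) metric tensor `q`, the pullback of `g` to the surface. -/
def inducedMetric (ι : N → M) (g : LorentzMetric n M) (p : N)
    (u v : TangentSpace (𝓡 (n - 1)) p) : ℝ :=
  g.val (ι p) (push ι p u) (push ι p v)

/-- `ι` embeds `N` as a null surface: an `(n-1)`-dimensional submanifold of the `n`-dimensional
space-time on which the pullback of the metric is degenerate at every point. -/
structure IsNullSurface (g : LorentzMetric n M) (ι : N → M) : Prop where
  embedding : Manifold.IsSmoothEmbedding (𝓡 (n - 1)) (𝓡 n) ∞ ι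
  degenerate : ∀ p : N, ∃ v : TangentSpace (𝓡 (n - 1)) p, v ≠ 0 ∧
    ∀ w : TangentSpace (𝓡 (n - 1)) p, inducedMetric ι g p v w = 0

/-- The vector `v` belongs to the null direction `L_p`, the degeneracy subspace of `q` at `p`. -/
def InNullDirection (g : LorentzMetric n M) (ι : N → M) (p : N)
    (v : TangentSpace (𝓡 (n - 1)) p) : Prop :=
  ∀ w : TangentSpace (𝓡 (n - 1)) p, inducedMetric ι g p v w = 0

/-- The space-time vector field `X'` is, near `ι p`, a smooth extension of the vector field `X`
tangent to the surface. -/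
structure IsExtensionAt (ι : N → M) (p : N) (X : VField (n - 1) N) (X' : VField n M) : Prop where
  smooth : SmoothAt X' (ι p)
  extends_near : ∀ᶠ y in 𝓝 p, X' (ι y) = push ι y (X y)

/-- The family `e` represents a `q`-orthonormal basis of the `(n-2)`-dimensional quotient
`T_p N / L_p`. -/
def IsScreenFrame (g : LorentzMetric n M) (ι : N → M) (p : N)
    (e : Fin (n - 2) → TangentSpace (𝓡 (n - 1)) p) : Prop :=
  ∀ i j, inducedMetric ι g p (e i) (e j) = if i = j then 1 else 0

/-- The null surface is non-expanding: around every point there is a null vector field `ℓ` tangent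
to the surface, not zero at the point, whose expansion, i.e. the trace of `g(∇_a ℓ, ·)` over
`T_p N / L_p`, vanishes at the point. -/
def IsNonExpanding (g : LorentzMetric n M) (nabla : Connection n M) (ι : N → M) : Prop :=
  ∀ p : N, ∃ (ℓ : VField (n - 1) N) (ℓ' : VField n M),
    SmoothAt ℓ p ∧ ℓ p ≠ 0 ∧ (∀ᶠ y in 𝓝 p, InNullDirection g ι y (ℓ y)) ∧
    IsExtensionAt ι p ℓ ℓ' ∧
    ∀ e : Fin (n - 2) → TangentSpace (𝓡 (n - 1)) p, IsScreenFrame g ι p e →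
      ∑ i, g.val (ι p) (nabla ℓ' (ι p) (push ι p (e i))) (push ι p (e i)) = 0

/-- `D` is the covariant derivative induced on the surface: `D_X Y = ∇_X Y` for all vector fields
`X`, `Y` tangent to the surface. -/
structure IsInducedConnection (nabla : Connection n M) (ι : N → M) (D : Connection (n - 1) N) :
    Prop where
  smooth : D.IsSmooth
  eq : ∀ (p : N) (Y : VField (n - 1) N) (Y' : VField n M), SmoothAt Y p → IsExtensionAt ι p Y Y' →
    ∀ v : TangentSpace (𝓡 (n - 1)) p, push ι p (D Y p v) = nabla Y' (ι p) (push ι p v)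

/-- The Lie derivative `(L_ℓ q)(X,Y)` at `p`. -/
def lieMetric (g : LorentzMetric n M) (ι : N → M) (ℓ X Y : VField (n - 1) N) (p : N) : ℝ :=
  mvfderiv (𝓡 (n - 1)) (fun y => inducedMetric ι g y (X y) (Y y)) p (ℓ p)
    - inducedMetric ι g p (VectorField.mlieBracket (𝓡 (n - 1)) ℓ X p) (Y p)
    - inducedMetric ι g p (X p) (VectorField.mlieBracket (𝓡 (n - 1)) ℓ Y p)

/-- The commutator `[L_ℓ, D]`, i.e. `L_ℓ (D_X Y) - D_{L_ℓ X} Y - D_X (L_ℓ Y)`, at `p`. -/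
def lieConnection (D : Connection (n - 1) N) (ℓ X Y : VField (n - 1) N) (p : N) :
    TangentSpace (𝓡 (n - 1)) p :=
  VectorField.mlieBracket (𝓡 (n - 1)) ℓ (D.along X Y) p
    - D Y p (VectorField.mlieBracket (𝓡 (n - 1)) ℓ X p)
    - D (VectorField.mlieBracket (𝓡 (n - 1)) ℓ Y) p (X p)

/-- `(N, [ℓ])` is an isolated null surface, with induced covariant derivative `D`: a non-expanding
null surface with a nowhere vanishing tangent null vector field `ℓ` whose flow preserves the
geometry `(q, D)`. The field `ℓ` stands for its class up to constant factors. -/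
structure IsIsolatedNullSurface (g : LorentzMetric n M) (nabla : Connection n M) (ι : N → M)
    (D : Connection (n - 1) N) (ℓ : VField (n - 1) N) : Prop where
  null : IsNullSurface g ι
  non_expanding : IsNonExpanding g nabla ι
  induced : IsInducedConnection nabla ι D
  flow_smooth : ∀ p, SmoothAt ℓ p
  flow_ne_zero : ∀ p, ℓ p ≠ 0
  flow_null : ∀ p, InNullDirection g ι p (ℓ p)
  lie_metric : ∀ (p : N) (X Y : VField (n - 1) N), SmoothAt X p → SmoothAt Y p →
    lieMetric g ι ℓ X Y p = 0
  lie_connection : ∀ (p : N) (X Y : VField (n - 1) N), SmoothAt X p → SmoothAt Y p →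
    lieConnection D ℓ X Y p = 0

/-- The surface gravity `κ`, given by `D_ℓ ℓ = κ ℓ`, vanishes nowhere. -/
def IsNonExtremal (D : Connection (n - 1) N) (ℓ : VField (n - 1) N) : Prop :=
  ∀ p, ∃ κ : ℝ, κ ≠ 0 ∧ D ℓ p (ℓ p) = κ • ℓ p

/-- `rot` is the rotation 1-form potential of `ℓ`: `D_a ℓ = rot_a ℓ`. -/
def IsRotationPotential (D : Connection (n - 1) N) (ℓ : VField (n - 1) N)
    (rot : Π p : N, TangentSpace (𝓡 (n - 1)) p →L[ℝ] ℝ) : Prop :=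
  ∀ (p : N) (v : TangentSpace (𝓡 (n - 1)) p), D ℓ p v = rot p v • ℓ p

end Surface

end NullSurface

end

/-!
On a null surface with a null field `ℓ` such that `D ℓ = ω ⊗ ℓ` and `[L_ℓ, D] = 0`, commuting
covariant derivatives gives `R(ℓ, v) w = F(v, w) ℓ` with
`F(v, w) = ω(D_v W) - v(ω(W)) - ω(w) ω(v)` for any extension `W` of `w`. By the Gauss equation and
the pair symmetry of the space-time curvature, the pulled-back space-time Ricci tensor is
`Ric_D(v, w) + F(w, v)`, and on `(v, ℓ)` it equals `-dκ(v)`, where `κ = ω(ℓ)`.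

Two connections induced on the same degenerate metric differ by a symmetric tensor
`C(v, w) = S(v, w) ℓ`. If the two null fields are `ℓ` and `f ℓ` and the pulled-back Ricci tensors
agree, then comparing them on the null direction gives `f dκ = d(f κ)`, so `f` is locally constant
where `κ ≠ 0`. The difference of the two intrinsic curvatures then has values in the span of `ℓ`,
so its trace can be read off on `ℓ`, and equality of the pulled-back Ricci tensors becomes
`ω(C(v, w)) + ω(C(w, v)) = 0`. Hence `κ S = 0`, and `C = 0` where the surface is non-extremal.
-/

open VectorField (mlieBracket)

noncomputable section

namespace NullSurface

section Regularity

theorem eventually_mdifferentiableAt_of_contMDiffAt {𝕜 : Type*} [NontriviallyNormedField 𝕜]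
    {E E' H H' M M' : Type*} [NormedAddCommGroup E] [NormedSpace 𝕜 E] [TopologicalSpace H]
    {I : ModelWithCorners 𝕜 E H} [TopologicalSpace M] [ChartedSpace H M] [IsManifold I 1 M]
    [NormedAddCommGroup E'] [NormedSpace 𝕜 E'] [TopologicalSpace H']
    {I' : ModelWithCorners 𝕜 E' H'} [TopologicalSpace M'] [ChartedSpace H' M'] [IsManifold I' 1 M']
    {f : M → M'} {x : M} {k : WithTop ℕ∞} (hf : ContMDiffAt I I' k f x) (hk : 1 ≤ k) :
    ∀ᶠ y in 𝓝 x, MDifferentiableAt I I' f y :=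
  ((contMDiffAt_iff_contMDiffAt_nhds (by simp)).1 (hf.of_le hk)).mono
    fun _ hy ↦ hy.mdifferentiableAt one_ne_zero

variable {n : ℕ} {M : Type*} [TopologicalSpace M] [ChartedSpace (EuclideanSpace ℝ (Fin n)) M]
  [IsManifold (𝓡 n) ∞ M] {X Y : VField n M} {f : M → ℝ} {x : M}

theorem SmoothAt.diffAt (hX : SmoothAt X x) : DiffAt X x :=
  ContMDiffAt.mdifferentiableAt hX (by simp)

theorem SmoothAt.eventually_diffAt (hX : SmoothAt X x) : ∀ᶠ y in 𝓝 x, DiffAt X y :=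
  eventually_mdifferentiableAt_of_contMDiffAt hX ENat.LEInfty.out

theorem SmoothAt.add (hX : SmoothAt X x) (hY : SmoothAt Y x) : SmoothAt (X + Y) x :=
  ContMDiffAt.add_section hX hY

theorem SmoothAt.sub (hX : SmoothAt X x) (hY : SmoothAt Y x) : SmoothAt (X - Y) x :=
  ContMDiffAt.sub_section hX hY

theorem SmoothAt.smul (hf : ContMDiffAt (𝓡 n) 𝓘(ℝ, ℝ) ∞ f x) (hX : SmoothAt X x) :
    SmoothAt (f • X) x :=
  ContMDiffAt.smul_section hf hX

theorem SmoothAt.sum {ι : Type*} {s : Finset ι} {V : ι → VField n M}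
    (hV : ∀ i, SmoothAt (V i) x) : SmoothAt (fun y ↦ ∑ i ∈ s, V i y) x :=
  ContMDiffAt.sum_section fun i _ ↦ hV i

theorem SmoothAt.congr (hX : SmoothAt X x) (h : ∀ᶠ y in 𝓝 x, Y y = X y) : SmoothAt Y x :=
  ContMDiffAt.congr_of_eventuallyEq hX (h.mono fun y hy ↦ by simp only [hy])

/-- A smooth vector field with the prescribed value `v` at the base point of `v`. -/
def localExtension (v : TangentSpace (𝓡 n) x) : VField n M :=
  FiberBundle.extend (EuclideanSpace ℝ (Fin n)) v

@[simp]
theorem localExtension_apply_self (v : TangentSpace (𝓡 n) x) : localExtension v x = v :=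
  FiberBundle.extend_apply_self _ v

theorem smoothAt_localExtension (v : TangentSpace (𝓡 n) x) : SmoothAt (localExtension v) x :=
  FiberBundle.contMDiffAt_extend (𝓡 n) _ v

/-- The derivative `X f` of the function `f` along the vector field `X`. -/
def dirDeriv (X : VField n M) (f : M → ℝ) : M → ℝ :=
  fun y ↦ mvfderiv (𝓡 n) f y (X y)

theorem contMDiffAt_dirDeriv (hX : SmoothAt X x) (hf : ContMDiffAt (𝓡 n) 𝓘(ℝ, ℝ) ∞ f x) :
    ContMDiffAt (𝓡 n) 𝓘(ℝ, ℝ) ∞ (dirDeriv X f) x := by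
  have hdf := hf.mfderiv_const (m := ∞) (by simp)
  have hXf := ContMDiffAt.clm_apply_of_inCoordinates (IM := 𝓡 n) (b₁ := id) (b₂ := f)
    (ϕ := fun y ↦ mfderiv (𝓡 n) 𝓘(ℝ, ℝ) f y) (v := X) hdf (by exact hX) hf
  rw [Bundle.contMDiffAt_totalSpace] at hXf
  simpa [dirDeriv, mvfderiv] using! hXf.2

end Regularity

section LieBracket

variable {n : ℕ} {M : Type*} [TopologicalSpace M] [ChartedSpace (EuclideanSpace ℝ (Fin n)) M]
  {X Y Z : VField n M} {f : M → ℝ} {x : M}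

theorem mlieBracket_congr_right (h : ∀ᶠ y in 𝓝 x, Y y = Z y) :
    mlieBracket (𝓡 n) X Y x = mlieBracket (𝓡 n) X Z x :=
  Filter.EventuallyEq.mlieBracket_vectorField_eq .rfl h

variable [IsManifold (𝓡 n) ∞ M]

theorem SmoothAt.mlieBracket (hX : SmoothAt X x) (hY : SmoothAt Y x) :
    SmoothAt (mlieBracket (𝓡 n) X Y) x := by
  have : IsManifold (𝓡 n) (∞ + 1) M := ‹IsManifold (𝓡 n) ∞ M›
  have : IsManifold (𝓡 n) (minSmoothness ℝ 2) M := by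
    rw [minSmoothness_of_isRCLikeNormedField]
    infer_instance
  exact ContMDiffAt.mlieBracket_vectorField hX hY (by simp)

theorem mlieBracket_jacobi (hX : SmoothAt X x) (hY : SmoothAt Y x) (hZ : SmoothAt Z x) :
    mlieBracket (𝓡 n) X (mlieBracket (𝓡 n) Y Z) x =
      mlieBracket (𝓡 n) (mlieBracket (𝓡 n) X Y) Z x +
        mlieBracket (𝓡 n) Y (mlieBracket (𝓡 n) X Z) x := by
  have : IsManifold (𝓡 n) (minSmoothness ℝ 3) M := by
    rw [minSmoothness_of_isRCLikeNormedField]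
    infer_instance
  have h2 : minSmoothness ℝ 2 ≤ (∞ : WithTop ℕ∞) := by
    rw [minSmoothness_of_isRCLikeNormedField]
    exact ENat.LEInfty.out
  exact VectorField.leibniz_identity_mlieBracket_apply (ContMDiffAt.of_le hX h2)
    (ContMDiffAt.of_le hY h2) (ContMDiffAt.of_le hZ h2)

theorem mlieBracket_mlieBracket_smul (hf : ContMDiffAt (𝓡 n) 𝓘(ℝ, ℝ) ∞ f x)
    (hY : SmoothAt Y x) (hZ : SmoothAt Z x) :
    mlieBracket (𝓡 n) X (mlieBracket (𝓡 n) Y (f • Z)) x =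
      dirDeriv X (dirDeriv Y f) x • Z x + dirDeriv Y f x • mlieBracket (𝓡 n) X Z x +
        (dirDeriv X f x • mlieBracket (𝓡 n) Y Z x +
          f x • mlieBracket (𝓡 n) X (mlieBracket (𝓡 n) Y Z) x) := by
  have expansion : ∀ᶠ y in 𝓝 x, mlieBracket (𝓡 n) Y (f • Z) y =
      (dirDeriv Y f • Z + f • mlieBracket (𝓡 n) Y Z) y := by
    filter_upwards [eventually_mdifferentiableAt_of_contMDiffAt hf ENat.LEInfty.out,
      hZ.eventually_diffAt] with y hfy hZy
    exact VectorField.mlieBracket_smul_right hfy hZy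
  have hYf := contMDiffAt_dirDeriv hY hf
  have hYZ := hY.mlieBracket hZ
  rw [mlieBracket_congr_right expansion,
    VectorField.mlieBracket_add_right (hZ.smul hYf).diffAt (hYZ.smul hf).diffAt,
    VectorField.mlieBracket_smul_right (hYf.mdifferentiableAt (by simp)) hZ.diffAt,
    VectorField.mlieBracket_smul_right (hf.mdifferentiableAt (by simp)) hYZ.diffAt]
  rfl

theorem dirDeriv_mlieBracket (hf : ContMDiffAt (𝓡 n) 𝓘(ℝ, ℝ) ∞ f x) (hX : SmoothAt X x)
    (hY : SmoothAt Y x) :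
    dirDeriv (mlieBracket (𝓡 n) X Y) f x =
      dirDeriv X (dirDeriv Y f) x - dirDeriv Y (dirDeriv X f) x := by
  rcases subsingleton_or_nontrivial (TangentSpace (𝓡 n) x) with _ | _
  · simp [dirDeriv, Subsingleton.elim _ (0 : TangentSpace (𝓡 n) x)]
  obtain ⟨w, hw⟩ := exists_ne (0 : TangentSpace (𝓡 n) x)
  have hZ := smoothAt_localExtension w
  -- The Jacobi identities for `X, Y, f • Z` and `X, Y, Z` differ by a multiple of `Z x = w`.
  have jacobi_smul := mlieBracket_jacobi hX hY (hZ.smul hf)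
  rw [mlieBracket_mlieBracket_smul hf hY hZ, mlieBracket_mlieBracket_smul hf hX hZ,
    VectorField.mlieBracket_smul_right (hf.mdifferentiableAt (by simp)) hZ.diffAt,
    mlieBracket_jacobi hX hY hZ, localExtension_apply_self, ← sub_eq_zero] at jacobi_smul
  rw [← sub_eq_zero, ← neg_eq_zero]
  refine (smul_eq_zero.1 ?_).resolve_right hw
  rw [← jacobi_smul]
  simp only [dirDeriv]
  module

end LieBracket

section Tensoriality

variable {n : ℕ} {M : Type*} [TopologicalSpace M] [ChartedSpace (EuclideanSpace ℝ (Fin n)) M]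
  [IsManifold (𝓡 n) ∞ M] {x : M} {A : Type*} [AddCommGroup A] [Module ℝ A] {Φ : VField n M → A}

/-- The operation `Φ` on vector fields is linear over the functions smooth at `x`, hence tensorial
at `x`. In contrast to Mathlib's `TensorialAt` it may involve higher derivatives of the field, so
only smooth functions and fields are admitted. -/
structure IsSmoothTensorial (Φ : VField n M → A) (x : M) : Prop where
  smul : ∀ {f : M → ℝ} {X : VField n M}, ContMDiffAt (𝓡 n) 𝓘(ℝ, ℝ) ∞ f x → SmoothAt X x →
    Φ (f • X) = f x • Φ X
  add : ∀ {X Y : VField n M}, SmoothAt X x → SmoothAt Y x → Φ (X + Y) = Φ X + Φ Y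

namespace IsSmoothTensorial

theorem congr (hΦ : IsSmoothTensorial Φ x) {X Y : VField n M} (hX : SmoothAt X x)
    (hY : SmoothAt Y x) (h : ∀ᶠ y in 𝓝 x, X y = Y y) : Φ X = Φ Y := by
  classical
  let ψ (y : M) : ℝ := if X y = Y y then 1 else 0
  have hψx : ψ x = 1 := if_pos h.self_of_nhds
  have hψ : ContMDiffAt (𝓡 n) 𝓘(ℝ, ℝ) ∞ ψ x :=
    (contMDiffAt_const (c := (1 : ℝ))).congr_of_eventuallyEq (h.mono fun y hy ↦ if_pos hy)
  have hψXY : ψ • X = ψ • Y := by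
    ext1 y
    by_cases hy : X y = Y y <;> simp [ψ, hy]
  simpa [hΦ.smul hψ hX, hΦ.smul hψ hY, hψx] using congrArg Φ hψXY

theorem sum (hΦ : IsSmoothTensorial Φ x) {ι : Type*} (s : Finset ι) {X : ι → VField n M}
    (hX : ∀ i, SmoothAt (X i) x) : Φ (fun y ↦ ∑ i ∈ s, X i y) = ∑ i ∈ s, Φ (X i) := by
  classical
  induction s using Finset.induction_on with
  | empty =>
    have hzero : SmoothAt (0 : VField n M) x := SmoothAt.sum (s := (∅ : Finset ι)) hX
    simpa using! hΦ.smul (f := fun _ ↦ 0) contMDiffAt_const hzero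
  | insert a s ha ih =>
    simp only [Finset.sum_insert ha, ← ih]
    exact hΦ.add (hX a) (SmoothAt.sum hX)

theorem apply_eq_of_eq_at (hΦ : IsSmoothTensorial Φ x) {X Y : VField n M} (hX : SmoothAt X x)
    (hY : SmoothAt Y x) (h : X x = Y x) : Φ X = Φ Y := by
  let t := trivializationAt (EuclideanSpace ℝ (Fin n)) (TangentSpace (𝓡 n) : M → Type _) x
  have hx : x ∈ t.baseSet := FiberBundle.mem_baseSet_trivializationAt _ _ x
  let b := Module.Basis.ofVectorSpace ℝ (EuclideanSpace ℝ (Fin n))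
  let s := t.localFrame b
  let c := t.localFrameCoeff (𝓡 n) b
  have hs (i) : SmoothAt (s i) x := contMDiffAt_localFrame_of_mem (I := 𝓡 n) ∞ _ b i hx
  have expansion {Z : VField n M} (hZ : SmoothAt Z x) : Φ Z = ∑ i, c i x (Z x) • Φ (s i) := by
    have hc (i) : ContMDiffAt (𝓡 n) 𝓘(ℝ, ℝ) ∞ (fun y ↦ c i y (Z y)) x :=
      contMDiffAt_localFrameCoeff b hx hZ i
    have hcs (i) : SmoothAt ((fun y ↦ c i y (Z y)) • s i) x := (hs i).smul (hc i)
    calc Φ Z = Φ (fun y ↦ ∑ i, ((fun y ↦ c i y (Z y)) • s i) y) :=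
          hΦ.congr hZ (SmoothAt.sum hcs) (t.eventually_eq_localFrame_sum_coeff_smul b hx)
      _ = ∑ i, Φ ((fun y ↦ c i y (Z y)) • s i) := hΦ.sum _ hcs
      _ = ∑ i, c i x (Z x) • Φ (s i) := Finset.sum_congr rfl fun i _ ↦ hΦ.smul (hc i) (hs i)
  rw [expansion hX, expansion hY, h]

/-- The linear map on the tangent space at `x` induced by an operation tensorial at `x`. -/
def toLinearMap (hΦ : IsSmoothTensorial Φ x) : TangentSpace (𝓡 n) x →ₗ[ℝ] A where
  toFun v := Φ (localExtension v)
  map_add' u v := by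
    have hu := smoothAt_localExtension u
    have hv := smoothAt_localExtension v
    rw [← hΦ.add hu hv]
    exact hΦ.apply_eq_of_eq_at (smoothAt_localExtension _) (hu.add hv) (by simp)
  map_smul' c v := by
    have hv := smoothAt_localExtension v
    rw [RingHom.id_apply, ← hΦ.smul (f := fun _ ↦ c) contMDiffAt_const hv]
    exact hΦ.apply_eq_of_eq_at (smoothAt_localExtension _) (hv.smul contMDiffAt_const) (by simp)

end IsSmoothTensorial

end Tensoriality

section Curvature

variable {n : ℕ} {M : Type*} [TopologicalSpace M] [ChartedSpace (EuclideanSpace ℝ (Fin n)) M]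
  [IsManifold (𝓡 n) ∞ M] {X Y Z V : VField n M} {f : M → ℝ} {x : M} {D : Connection n M}

theorem Connection.congr_of_eventually (hY : DiffAt Y x) (hZ : DiffAt Z x)
    (h : ∀ᶠ y in 𝓝 x, Y y = Z y) : D Y x = D Z x :=
  D.isCovariantDerivativeOnUniv.congr_of_eventuallyEq hY hZ Filter.univ_mem h

theorem Connection.add_apply (hY : DiffAt Y x) (hZ : DiffAt Z x) (v : TangentSpace (𝓡 n) x) :
    D (Y + Z) x v = D Y x v + D Z x v := by
  rw [D.isCovariantDerivativeOnUniv.add hY hZ, _root_.add_apply]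

theorem Connection.smul_apply (hf : MDifferentiableAt (𝓡 n) 𝓘(ℝ, ℝ) f x) (hY : DiffAt Y x)
    (v : TangentSpace (𝓡 n) x) :
    D (f • Y) x v = f x • D Y x v + mvfderiv (𝓡 n) f x v • Y x := by
  rw [D.isCovariantDerivativeOnUniv.leibniz hY hf]
  simp

theorem Connection.apply_along_add (hD : D.IsSmooth) (hV : SmoothAt V x) (hY : SmoothAt Y x)
    (hZ : SmoothAt Z x) (v : TangentSpace (𝓡 n) x) :
    D (D.along V (Y + Z)) x v = D (D.along V Y) x v + D (D.along V Z) x v := by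
  have hVY := hD x V Y hV hY
  have hVZ := hD x V Z hV hZ
  rw [← D.add_apply hVY.diffAt hVZ.diffAt]
  refine congrArg (· v) (D.congr_of_eventually (hD x V _ hV (hY.add hZ)).diffAt
    (hVY.add hVZ).diffAt ?_)
  filter_upwards [hY.eventually_diffAt, hZ.eventually_diffAt] with y hYy hZy
  exact D.add_apply hYy hZy (V y)

theorem Connection.apply_along_smul (hD : D.IsSmooth) (hf : ContMDiffAt (𝓡 n) 𝓘(ℝ, ℝ) ∞ f x)
    (hV : SmoothAt V x) (hZ : SmoothAt Z x) (v : TangentSpace (𝓡 n) x) :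
    D (D.along V (f • Z)) x v =
      f x • D (D.along V Z) x v + mvfderiv (𝓡 n) f x v • D Z x (V x) +
        (dirDeriv V f x • D Z x v + mvfderiv (𝓡 n) (dirDeriv V f) x v • Z x) := by
  have hVZ := hD x V Z hV hZ
  have hVf := contMDiffAt_dirDeriv hV hf
  have expansion : ∀ᶠ y in 𝓝 x, D.along V (f • Z) y = (f • D.along V Z + dirDeriv V f • Z) y := by
    filter_upwards [eventually_mdifferentiableAt_of_contMDiffAt hf ENat.LEInfty.out,
      hZ.eventually_diffAt] with y hfy hZy
    exact D.smul_apply hfy hZy (V y)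
  rw [D.congr_of_eventually (hD x V _ hV (hZ.smul hf)).diffAt
      ((hVZ.smul hf).add (hZ.smul hVf)).diffAt expansion,
    D.add_apply (hVZ.smul hf).diffAt (hZ.smul hVf).diffAt,
    D.smul_apply (hf.mdifferentiableAt (by simp)) hVZ.diffAt,
    D.smul_apply (hVf.mdifferentiableAt (by simp)) hZ.diffAt]
  rfl

theorem curvature_swap (X Y Z : VField n M) (x : M) :
    curvature D X Y Z x = -curvature D Y X Z x := by
  simp only [curvature]
  rw [VectorField.mlieBracket_swap_apply, map_neg]
  abel

theorem isSmoothTensorial_curvature_left (hD : D.IsSmooth) (hZ : SmoothAt Z x) :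
    IsSmoothTensorial (fun X ↦ curvature D X Y Z x) x where
  smul {f X} hf hX := by
    have along_smul : D.along (f • X) Z = f • D.along X Z := by
      ext1 y
      simp [Connection.along]
    have hf' := hf.mdifferentiableAt (by simp)
    simp only [curvature, along_smul]
    rw [D.smul_apply hf' (hD x X Z hX hZ).diffAt, VectorField.mlieBracket_smul_left hf' hX.diffAt]
    simp only [Pi.smul_apply', map_smul, map_add, map_neg, neg_smul, Connection.along]
    module
  add {X X'} hX hX' := by
    have along_add : D.along (X + X') Z = D.along X Z + D.along X' Z := by
      ext1 y
      simp [Connection.along]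
    simp only [curvature, along_add]
    rw [D.add_apply (hD x X Z hX hZ).diffAt (hD x X' Z hX' hZ).diffAt,
      VectorField.mlieBracket_add_left hX.diffAt hX'.diffAt]
    simp only [Pi.add_apply, map_add]
    module

theorem isSmoothTensorial_curvature_middle (hD : D.IsSmooth) (hZ : SmoothAt Z x) :
    IsSmoothTensorial (fun Y ↦ curvature D X Y Z x) x where
  smul {f Y} hf hY := by
    simp only [curvature_swap X, (isSmoothTensorial_curvature_left hD hZ).smul hf hY, smul_neg]
  add {Y Y'} hY hY' := by
    simp only [curvature_swap X, (isSmoothTensorial_curvature_left hD hZ).add hY hY', neg_add]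

theorem isSmoothTensorial_curvature_right (hD : D.IsSmooth) (hX : SmoothAt X x)
    (hY : SmoothAt Y x) : IsSmoothTensorial (fun Z ↦ curvature D X Y Z x) x where
  smul {f Z} hf hZ := by
    have commutator := dirDeriv_mlieBracket hf hX hY
    simp only [dirDeriv] at commutator
    simp only [curvature]
    rw [Connection.apply_along_smul hD hf hX hZ, Connection.apply_along_smul hD hf hY hZ,
      D.smul_apply (hf.mdifferentiableAt (by simp)) hZ.diffAt, commutator]
    simp only [dirDeriv]
    module
  add {Z Z'} hZ hZ' := by
    simp only [curvature]
    rw [Connection.apply_along_add hD hX hZ hZ', Connection.apply_along_add hD hY hZ hZ',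
      D.add_apply hZ.diffAt hZ'.diffAt]
    module

theorem curvature_eq_curvatureAt (hD : D.IsSmooth) (hX : SmoothAt X x) (hY : SmoothAt Y x)
    (hZ : SmoothAt Z x) : curvature D X Y Z x = curvatureAt D x (X x) (Y x) (Z x) := by
  have hX' := smoothAt_localExtension (X x)
  have hY' := smoothAt_localExtension (Y x)
  have hZ' := smoothAt_localExtension (Z x)
  rw [(isSmoothTensorial_curvature_left hD hZ).apply_eq_of_eq_at hX hX' (by simp),
    (isSmoothTensorial_curvature_middle hD hZ).apply_eq_of_eq_at hY hY' (by simp),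
    (isSmoothTensorial_curvature_right hD hX' hY').apply_eq_of_eq_at hZ hZ' (by simp)]
  rfl

theorem curvatureAt_swap (u v w : TangentSpace (𝓡 n) x) :
    curvatureAt D x u v w = -curvatureAt D x v u w :=
  curvature_swap _ _ _ x

/-- The endomorphism `u ↦ R(u, v) w` of the tangent space, whose trace is `Ric(v, w)`. -/
def curvatureMap (hD : D.IsSmooth) (x : M) (v w : TangentSpace (𝓡 n) x) :
    TangentSpace (𝓡 n) x →ₗ[ℝ] TangentSpace (𝓡 n) x :=
  (isSmoothTensorial_curvature_left hD (Y := localExtension v)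
    (smoothAt_localExtension w)).toLinearMap

theorem curvatureMap_apply (hD : D.IsSmooth) (u v w : TangentSpace (𝓡 n) x) :
    curvatureMap hD x v w u = curvatureAt D x u v w := rfl

theorem curvatureAt_smul_left (hD : D.IsSmooth) (c : ℝ) (u v w : TangentSpace (𝓡 n) x) :
    curvatureAt D x (c • u) v w = c • curvatureAt D x u v w :=
  (curvatureMap hD x v w).map_smul c u

theorem curvatureAt_smul_right (hD : D.IsSmooth) (c : ℝ) (u v w : TangentSpace (𝓡 n) x) :
    curvatureAt D x u v (c • w) = c • curvatureAt D x u v w :=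
  (isSmoothTensorial_curvature_right hD (smoothAt_localExtension u)
    (smoothAt_localExtension v)).toLinearMap.map_smul c w

theorem ricci_smul_right (hD : D.IsSmooth) (c : ℝ) (v w : TangentSpace (𝓡 n) x) :
    ricci D x v (c • w) = c * ricci D x v w := by
  simp only [ricci, curvatureAt_smul_right hD, map_smul, Finsupp.smul_apply, smul_eq_mul,
    Finset.mul_sum]

theorem ricci_eq_trace (hD : D.IsSmooth) (v w : TangentSpace (𝓡 n) x) :
    ricci D x v w = LinearMap.trace ℝ (TangentSpace (𝓡 n) x) (curvatureMap hD x v w) := by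
  rw [LinearMap.trace_eq_matrix_trace ℝ (tangentBasis x), Matrix.trace]
  simp only [ricci, Matrix.diag, LinearMap.toMatrix_apply, curvatureMap_apply]

end Curvature

section LeviCivita

variable {n : ℕ} {M : Type*} [TopologicalSpace M] [ChartedSpace (EuclideanSpace ℝ (Fin n)) M]
  [IsManifold (𝓡 n) ∞ M] {X Y Z W : VField n M} {x : M} {D nabla : Connection n M}
  {g : LorentzMetric n M}

theorem Connection.apply_comm_of_torsion_eq_zero (hT : D.torsion = 0) (hX : DiffAt X x)
    (hY : DiffAt Y x) : D Y x (X x) = D X x (Y x) + mlieBracket (𝓡 n) X Y x := by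
  rw [← D.torsion_eq_zero_iff.1 hT hX hY]
  abel

theorem Connection.apply_along_comm_of_torsion_eq_zero (hD : D.IsSmooth) (hT : D.torsion = 0)
    (hX : SmoothAt X x) (hY : SmoothAt Y x) (hZ : SmoothAt Z x) :
    D (D.along Y Z) x (X x) = D (D.along Z Y) x (X x) + D X x (mlieBracket (𝓡 n) Y Z x) +
      mlieBracket (𝓡 n) X (mlieBracket (𝓡 n) Y Z) x := by
  have hZY := hD x Z Y hZ hY
  have hbracket := hY.mlieBracket hZ
  have along_comm : ∀ᶠ y in 𝓝 x, D.along Y Z y = (D.along Z Y + mlieBracket (𝓡 n) Y Z) y := by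
    filter_upwards [hY.eventually_diffAt, hZ.eventually_diffAt] with y hYy hZy
    exact Connection.apply_comm_of_torsion_eq_zero hT hYy hZy
  rw [D.congr_of_eventually (hD x Y Z hY hZ).diffAt (hZY.add hbracket).diffAt along_comm,
    D.add_apply hZY.diffAt hbracket.diffAt,
    Connection.apply_comm_of_torsion_eq_zero hT hX.diffAt hbracket.diffAt, add_assoc]

theorem curvatureAt_bianchi (hD : D.IsSmooth) (hT : D.torsion = 0)
    (u v w : TangentSpace (𝓡 n) x) :
    curvatureAt D x u v w + curvatureAt D x v w u + curvatureAt D x w u v = 0 := by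
  have hX := smoothAt_localExtension u
  have hY := smoothAt_localExtension v
  have hZ := smoothAt_localExtension w
  change curvature D (localExtension u) (localExtension v) (localExtension w) x +
    curvature D (localExtension v) (localExtension w) (localExtension u) x +
    curvature D (localExtension w) (localExtension u) (localExtension v) x = 0
  have bracket_swap : mlieBracket (𝓡 n) (localExtension v)
      (mlieBracket (𝓡 n) (localExtension w) (localExtension u)) x =
      -mlieBracket (𝓡 n) (localExtension v)
        (mlieBracket (𝓡 n) (localExtension u) (localExtension w)) x := by
    rw [VectorField.mlieBracket_swap (V := localExtension w)]
    simpa using! VectorField.mlieBracket_const_smul_right (V := localExtension v) (c := (-1 : ℝ))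
      (hX.mlieBracket hZ).diffAt
  simp only [curvature]
  rw [Connection.apply_along_comm_of_torsion_eq_zero hD hT hX hY hZ,
    Connection.apply_along_comm_of_torsion_eq_zero hD hT hY hZ hX,
    Connection.apply_along_comm_of_torsion_eq_zero hD hT hZ hX hY, bracket_swap,
    mlieBracket_jacobi hX hY hZ, VectorField.mlieBracket_swap_apply (V := localExtension w)
      (W := mlieBracket (𝓡 n) (localExtension u) (localExtension v))]
  abel

theorem LorentzMetric.contMDiffAt_apply (hY : SmoothAt Y x) (hZ : SmoothAt Z x) :
    ContMDiffAt (𝓡 n) 𝓘(ℝ, ℝ) ∞ (fun y ↦ g.val y (Y y) (Z y)) x := by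
  have h := ContMDiffAt.clm_bundle_apply₂ (IB := 𝓡 n) (n := ∞)
    (F₁ := EuclideanSpace ℝ (Fin n)) (E₁ := (TangentSpace (𝓡 n) : M → Type _))
    (F₂ := EuclideanSpace ℝ (Fin n)) (E₂ := (TangentSpace (𝓡 n) : M → Type _))
    (F₃ := ℝ) (E₃ := fun _ : M ↦ ℝ) (IM := 𝓡 n) (b := id) (x := x)
    (ψ := g.val) (v := Y) (w := Z) (g.smooth x) hY hZ
  rw [Bundle.contMDiffAt_totalSpace] at h
  simpa using! h.2

namespace IsLeviCivita

theorem dirDeriv_metric (h : IsLeviCivita g nabla) (hY : DiffAt Y x) (hZ : DiffAt Z x) :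
    dirDeriv X (fun y ↦ g.val y (Y y) (Z y)) x =
      g.val x (nabla.along X Y x) (Z x) + g.val x (Y x) (nabla.along X Z x) :=
  h.metric x Y Z hY hZ (X x)

theorem dirDeriv_dirDeriv_metric (h : IsLeviCivita g nabla) (hY : SmoothAt Y x)
    (hZ : SmoothAt Z x) (hW : SmoothAt W x) :
    dirDeriv X (dirDeriv Y fun y ↦ g.val y (Z y) (W y)) x =
      g.val x (nabla.along X (nabla.along Y Z) x) (W x) +
        g.val x (nabla.along Y Z x) (nabla.along X W x) +
        (g.val x (nabla.along X Z x) (nabla.along Y W x) +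
          g.val x (Z x) (nabla.along X (nabla.along Y W) x)) := by
  have hYZ := h.smooth x Y Z hY hZ
  have hYW := h.smooth x Y W hY hW
  have expansion : dirDeriv Y (fun y ↦ g.val y (Z y) (W y)) =ᶠ[𝓝 x]
      (fun y ↦ g.val y (nabla.along Y Z y) (W y)) +
        fun y ↦ g.val y (Z y) (nabla.along Y W y) := by
    filter_upwards [hZ.eventually_diffAt, hW.eventually_diffAt] with y hZy hWy
    exact h.dirDeriv_metric hZy hWy
  rw [← h.dirDeriv_metric hYZ.diffAt hW.diffAt, ← h.dirDeriv_metric hZ.diffAt hYW.diffAt]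
  simp only [dirDeriv, mvfderiv] at expansion ⊢
  rw [expansion.mfderiv_eq]
  exact congrArg (· (X x)) (mvfderiv_add
    ((LorentzMetric.contMDiffAt_apply hYZ hW).mdifferentiableAt (by simp))
    ((LorentzMetric.contMDiffAt_apply hZ hYW).mdifferentiableAt (by simp)))

theorem metric_curvatureAt_swap (h : IsLeviCivita g nabla) (u v w z : TangentSpace (𝓡 n) x) :
    g.val x (curvatureAt nabla x u v w) z = -g.val x (curvatureAt nabla x u v z) w := by
  have hX := smoothAt_localExtension u
  have hY := smoothAt_localExtension v
  have hZ := smoothAt_localExtension w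
  have hW := smoothAt_localExtension z
  change g.val x (curvature nabla (localExtension u) (localExtension v) (localExtension w) x) z =
    -g.val x (curvature nabla (localExtension u) (localExtension v) (localExtension z) x) w
  have commutator := dirDeriv_mlieBracket
    (LorentzMetric.contMDiffAt_apply (g := g) hZ hW) hX hY
  rw [h.dirDeriv_metric hZ.diffAt hW.diffAt, h.dirDeriv_dirDeriv_metric hY hZ hW,
    h.dirDeriv_dirDeriv_metric hX hZ hW] at commutator
  simp only [Connection.along, localExtension_apply_self, g.symm x w] at commutator
  simp only [curvature, map_sub, sub_apply, localExtension_apply_self]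
  linarith

end IsLeviCivita

theorem pair_symm_of_bianchi {α : Type*} {R : α → α → α → α → ℝ}
    (antisymm_left : ∀ a b c d, R a b c d = -R b a c d)
    (antisymm_right : ∀ a b c d, R a b c d = -R a b d c)
    (bianchi : ∀ a b c d, R a b c d + R b c a d + R c a b d = 0) (a b c d : α) :
    R a b c d = R c d a b := by
  linarith [bianchi a b c d, bianchi b c d a, bianchi c d a b, bianchi d a b c,
    antisymm_left b c a d, antisymm_left c a b d, antisymm_left c d b a, antisymm_left d b c a,
    antisymm_left d a c b, antisymm_left a c d b, antisymm_left a b d c, antisymm_left b d a c,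
    antisymm_right a b c d, antisymm_right b c a d, antisymm_right c a b d, antisymm_right c d a b,
    antisymm_right b d c a, antisymm_right d a b c, antisymm_right a c b d, antisymm_right d b a c,
    antisymm_right a d c b]

theorem IsLeviCivita.metric_curvatureAt_pair_symm (h : IsLeviCivita g nabla)
    (a b c d : TangentSpace (𝓡 n) x) :
    g.val x (curvatureAt nabla x a b c) d = g.val x (curvatureAt nabla x c d a) b := by
  refine pair_symm_of_bianchi (R := fun a b c d ↦ g.val x (curvatureAt nabla x a b c) d)
    (fun a b c d ↦ ?_) h.metric_curvatureAt_swap (fun a b c d ↦ ?_) a b c d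
  · simp only [curvatureAt_swap a b, map_neg, neg_apply]
  · simp only [← add_apply, ← map_add, curvatureAt_bianchi h.smooth h.torsion_free, map_zero,
      zero_apply]

end LeviCivita

section Einstein

variable {n : ℕ} {M : Type*} [TopologicalSpace M] [ChartedSpace (EuclideanSpace ℝ (Fin n)) M]
  [IsManifold (𝓡 n) ∞ M] {g : LorentzMetric n M} {nabla : Connection n M} {x : M}

theorem LorentzMetric.eq_zero_of_orthogonal {v : TangentSpace (𝓡 n) x}
    (h : ∀ w, g.val x w v = 0) : v = 0 := by
  by_contra hv
  obtain ⟨t, -, ht⟩ := g.signature x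
  exact (ht v (h t) hv).ne' (h v)

theorem LorentzMetric.nondegenerate : (g.val x).toBilinForm.Nondegenerate :=
  ⟨fun _ h ↦ eq_zero_of_orthogonal fun w ↦ (g.symm x w _).trans (h w),
    fun _ h ↦ eq_zero_of_orthogonal h⟩

theorem LorentzMetric.sum_inv_mul_self :
    ∑ i, ∑ j, (Matrix.of fun k l ↦ g.val x (tangentBasis x k) (tangentBasis x l))⁻¹ i j *
      g.val x (tangentBasis x i) (tangentBasis x j) = n := by
  set G := Matrix.of fun k l ↦ g.val x (tangentBasis x k) (tangentBasis x l)
  have G_eq : G = LinearMap.BilinForm.toMatrix (tangentBasis x) (g.val x).toBilinForm := by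
    ext i j
    exact (LinearMap.BilinForm.toMatrix_apply (tangentBasis x) (g.val x).toBilinForm i j).symm
  have det_ne_zero : G.det ≠ 0 :=
    G_eq ▸ (LinearMap.BilinForm.nondegenerate_iff_det_ne_zero (tangentBasis x)).1 g.nondegenerate
  calc ∑ i, ∑ j, G⁻¹ i j * g.val x (tangentBasis x i) (tangentBasis x j)
    _ = (G⁻¹ * G).trace := Finset.sum_congr rfl fun i _ ↦ Finset.sum_congr rfl fun j _ ↦ 
      congrArg (G⁻¹ i j * ·) (g.symm x _ _)
    _ = n := by
      rw [Matrix.nonsing_inv_mul _ (isUnit_iff_ne_zero.2 det_ne_zero), Matrix.trace_one,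
        Fintype.card_fin]

theorem scalarCurvature_of_ricci_eq {c : ℝ} (h : ∀ u v, ricci nabla x u v = c * g.val x u v) :
    scalarCurvature g nabla x = c * n := by
  simp only [scalarCurvature, h, ← g.sum_inv_mul_self (x := x), Finset.mul_sum, mul_left_comm]

theorem VacuumEinsteinOn.ricci_eq {Λ : ℝ} {S : Set M} (h : VacuumEinsteinOn g nabla Λ S)
    (hn : 2 < n) (hx : x ∈ S) (u v : TangentSpace (𝓡 n) x) :
    ricci nabla x u v = 2 * Λ / (n - 2) * g.val x u v := by
  set R := scalarCurvature g nabla x with hR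
  have ricci_eq (u v) : ricci nabla x u v = (R / 2 - Λ) * g.val x u v := by
    have := h x hx u v
    rw [einstein, ← hR] at this
    linarith
  have R_eq : R = (R / 2 - Λ) * n := scalarCurvature_of_ricci_eq ricci_eq
  have two_lt : (2 : ℝ) < n := by exact_mod_cast hn
  rw [ricci_eq, eq_div_of_mul_eq (sub_ne_zero.2 two_lt.ne') (by linarith :
    (R / 2 - Λ) * (n - 2) = 2 * Λ)]

end Einstein

section Trace

variable {K V W : Type*} [Field K] [AddCommGroup V] [Module K V] [FiniteDimensional K V]
  [AddCommGroup W] [Module K W] [FiniteDimensional K W]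

theorem trace_eq_trace_add_of_intertwines {P : W →ₗ[K] V} (hP : Function.Injective P)
    {φ : V →ₗ[K] K} (hφ : LinearMap.ker φ = LinearMap.range P) {k : V} (hk : φ k = 1)
    {A : V →ₗ[K] V} {B : W →ₗ[K] W} (hAB : A ∘ₗ P = P ∘ₗ B) :
    LinearMap.trace K V A = LinearMap.trace K W B + φ (A k) := by
  obtain ⟨π₀, hπ₀⟩ := P.exists_leftInverse_of_injective (LinearMap.ker_eq_bot.2 hP)
  set π : V →ₗ[K] W := π₀ ∘ₗ (LinearMap.id - φ.smulRight k) with hπ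
  have π_P : π ∘ₗ P = LinearMap.id := by
    ext w
    have φ_P : φ (P w) = 0 := LinearMap.mem_ker.1 (hφ ▸ LinearMap.mem_range_self P w)
    simpa [hπ, φ_P] using LinearMap.congr_fun hπ₀ w
  have P_π (v : V) : P (π v) = v - φ v • k := by
    have mem_range : v - φ v • k ∈ LinearMap.range P := by simp [← hφ, hk]
    obtain ⟨w, hw⟩ := mem_range
    simpa [hπ, ← hw] using congrArg P (LinearMap.congr_fun hπ₀ w)
  have decomposition : A = (A ∘ₗ P) ∘ₗ π + φ.smulRight (A k) := by
    ext v
    simp [P_π]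
  calc LinearMap.trace K V A
    _ = LinearMap.trace K V (P ∘ₗ (B ∘ₗ π)) + φ (A k) := by
      rw [← LinearMap.comp_assoc, ← hAB, ← LinearMap.trace_smulRight φ (A k), ← map_add,
        ← decomposition]
    _ = LinearMap.trace K W B + φ (A k) := by
      rw [LinearMap.trace_comp_comm', LinearMap.comp_assoc, π_P, LinearMap.comp_id]

theorem trace_eq_of_range_le_span {B : W →ₗ[K] W} {l : W} (hl : l ≠ 0)
    (hB : LinearMap.range B ≤ K ∙ l) {c : K} (hc : B l = c • l) : LinearMap.trace K W B = c := by
  obtain ⟨f, hf⟩ := Module.Projective.exists_dual_ne_zero K hl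
  have rank_one : B = ((f l)⁻¹ • f ∘ₗ B).smulRight l := by
    ext u
    obtain ⟨r, hr⟩ := Submodule.mem_span_singleton.1 (hB (LinearMap.mem_range_self B u))
    simp [← hr, mul_left_comm (f l)⁻¹, inv_mul_cancel₀ hf]
  rw [rank_one, LinearMap.trace_smulRight]
  simp [hc, mul_left_comm (f l)⁻¹, inv_mul_cancel₀ hf]

end Trace

section Difference

variable {n : ℕ} {M : Type*} [TopologicalSpace M] [ChartedSpace (EuclideanSpace ℝ (Fin n)) M]

instance (x : M) : FiniteDimensional ℝ (TangentSpace (𝓡 n) x) :=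
  inferInstanceAs (FiniteDimensional ℝ (EuclideanSpace ℝ (Fin n)))

variable [IsManifold (𝓡 n) ∞ M] {Y : VField n M} {x : M} {D D₁ D₂ : Connection n M}

/-- The field `q` of bilinear forms is parallel for `D`: the Leibniz rule holds for `q(Y, Z)`. -/
def Connection.Preserves (D : Connection n M)
    (q : Π x : M, LinearMap.BilinForm ℝ (TangentSpace (𝓡 n) x)) : Prop :=
  ∀ ⦃x : M⦄ ⦃Y Z : VField n M⦄, SmoothAt Y x → SmoothAt Z x → ∀ u : TangentSpace (𝓡 n) x,
    mvfderiv (𝓡 n) (fun y ↦ q y (Y y) (Z y)) x u = q x (D Y x u) (Z x) + q x (Y x) (D Z x u)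

theorem Connection.eq_add_difference (D₁ D₂ : Connection n M) (hY : DiffAt Y x)
    (v : TangentSpace (𝓡 n) x) :
    D₁ Y x v = D₂ Y x v + CovariantDerivative.difference D₁ D₂ x (Y x) v := by
  have difference_apply : CovariantDerivative.difference D₁ D₂ x (Y x) = D₁ Y x - D₂ Y x :=
    IsCovariantDerivativeOn.difference_apply D₁.isCovariantDerivativeOnUniv
      D₂.isCovariantDerivativeOnUniv trivial hY
  rw [difference_apply, sub_apply, add_sub_cancel]

theorem difference_comm_of_torsion_eq_zero (hT₁ : D₁.torsion = 0) (hT₂ : D₂.torsion = 0)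
    (u v : TangentSpace (𝓡 n) x) :
    CovariantDerivative.difference D₁ D₂ x u v = CovariantDerivative.difference D₁ D₂ x v u := by
  have hX := (smoothAt_localExtension u).diffAt
  have hY := (smoothAt_localExtension v).diffAt
  have comm₁ := Connection.apply_comm_of_torsion_eq_zero hT₁ hY hX
  have comm₂ := Connection.apply_comm_of_torsion_eq_zero hT₂ hY hX
  rw [D₁.eq_add_difference D₂ hX, D₁.eq_add_difference D₂ hY, comm₂] at comm₁
  simp only [localExtension_apply_self] at comm₁
  rw [add_right_comm] at comm₁
  exact add_left_cancel (add_right_cancel comm₁)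

theorem Connection.Preserves.apply_difference_add
    {q : Π x : M, LinearMap.BilinForm ℝ (TangentSpace (𝓡 n) x)}
    (h₁ : D₁.Preserves q) (h₂ : D₂.Preserves q) (u v w : TangentSpace (𝓡 n) x) :
    q x (CovariantDerivative.difference D₁ D₂ x u w) v +
      q x u (CovariantDerivative.difference D₁ D₂ x v w) = 0 := by
  have hY := smoothAt_localExtension u
  have hZ := smoothAt_localExtension v
  have leibniz₁ := h₁ hY hZ w
  rw [h₂ hY hZ w, D₁.eq_add_difference D₂ hY.diffAt, D₁.eq_add_difference D₂ hZ.diffAt] at leibniz₁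
  simp only [localExtension_apply_self, map_add, LinearMap.add_apply] at leibniz₁
  linarith

theorem Connection.Preserves.apply_difference_eq_zero
    {q : Π x : M, LinearMap.BilinForm ℝ (TangentSpace (𝓡 n) x)}
    (hq : ∀ u v : TangentSpace (𝓡 n) x, q x u v = q x v u)
    (h₁ : D₁.Preserves q) (h₂ : D₂.Preserves q) (hT₁ : D₁.torsion = 0) (hT₂ : D₂.torsion = 0)
    (u v w : TangentSpace (𝓡 n) x) : q x (CovariantDerivative.difference D₁ D₂ x u v) w = 0 := by
  have comm (a b) := difference_comm_of_torsion_eq_zero (x := x) hT₁ hT₂ a b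
  have skew (a b c) := h₁.apply_difference_add (x := x) h₂ a b c
  have skew_uwv := skew u w v
  have skew_wvu := skew w v u
  have skew_vuw := skew v u w
  rw [comm w v, hq u] at skew_uwv
  rw [comm w u, comm v u, hq w] at skew_wvu
  rw [hq v] at skew_vuw
  linarith

theorem ricci_sub_ricci_of_curvatureAt_sub_mem_span (hD₁ : D₁.IsSmooth) (hD₂ : D₂.IsSmooth)
    {l v w : TangentSpace (𝓡 n) x} (hl : l ≠ 0)
    (h : ∀ u, curvatureAt D₁ x u v w - curvatureAt D₂ x u v w ∈ ℝ ∙ l) {c₁ c₂ : ℝ}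
    (hc₁ : curvatureAt D₁ x l v w = c₁ • l) (hc₂ : curvatureAt D₂ x l v w = c₂ • l) :
    ricci D₁ x v w - ricci D₂ x v w = c₁ - c₂ := by
  rw [ricci_eq_trace hD₁, ricci_eq_trace hD₂, ← map_sub]
  refine trace_eq_of_range_le_span hl ?_ ?_
  · rintro _ ⟨u, rfl⟩
    exact h u
  · rw [LinearMap.sub_apply, curvatureMap_apply, curvatureMap_apply, hc₁, hc₂, sub_smul]

end Difference

section CoordinateFields

theorem mlieBracket_const {E : Type*} [NormedAddCommGroup E] [NormedSpace ℝ E] (a b z : E) :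
    mlieBracket 𝓘(ℝ, E) (fun _ : E ↦ (a : E)) (fun _ : E ↦ (b : E)) z = 0 := by
  have mlieBracket_eq (V W : Π z : E, TangentSpace 𝓘(ℝ, E) z) :
      mlieBracket 𝓘(ℝ, E) V W z = VectorField.lieBracketWithin ℝ V W Set.univ z := by
    rw [← VectorField.mlieBracketWithin_univ, VectorField.mlieBracketWithin_eq_lieBracketWithin]
  refine (mlieBracket_eq (fun _ ↦ a) fun _ ↦ b).trans ?_
  simp only [VectorField.lieBracketWithin, fderivWithin_fun_const]
  exact sub_self _

variable {n : ℕ} {M : Type*} [TopologicalSpace M] [ChartedSpace (EuclideanSpace ℝ (Fin n)) M]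

/-- The vector field whose components in the chart `φ` are `V`, a function of the coordinates. -/
def coordField (φ : OpenPartialHomeomorph M (EuclideanSpace ℝ (Fin n)))
    (V : EuclideanSpace ℝ (Fin n) → EuclideanSpace ℝ (Fin n)) : VField n M :=
  VectorField.mpullback (𝓡 n) 𝓘(ℝ, EuclideanSpace ℝ (Fin n)) φ V

variable {φ : OpenPartialHomeomorph M (EuclideanSpace ℝ (Fin n))}
  {V : EuclideanSpace ℝ (Fin n) → EuclideanSpace ℝ (Fin n)} {y : M}

theorem mdifferentiable_of_mem_maximalAtlas (hφ : φ ∈ IsManifold.maximalAtlas (𝓡 n) ∞ M) :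
    φ.MDifferentiable (𝓡 n) 𝓘(ℝ, EuclideanSpace ℝ (Fin n)) :=
  ⟨(contMDiffOn_of_mem_maximalAtlas hφ).mdifferentiableOn (by simp),
    (contMDiffOn_symm_of_mem_maximalAtlas hφ).mdifferentiableOn (by simp)⟩

theorem isInvertible_mfderiv_of_mem_maximalAtlas (hφ : φ ∈ IsManifold.maximalAtlas (𝓡 n) ∞ M)
    (hy : y ∈ φ.source) :
    (mfderiv (𝓡 n) 𝓘(ℝ, EuclideanSpace ℝ (Fin n)) φ y).IsInvertible :=
  ⟨(mdifferentiable_of_mem_maximalAtlas hφ).mfderiv hy, rfl⟩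

theorem mfderiv_coordField (hφ : φ ∈ IsManifold.maximalAtlas (𝓡 n) ∞ M) (hy : y ∈ φ.source) :
    mfderiv (𝓡 n) 𝓘(ℝ, EuclideanSpace ℝ (Fin n)) φ y (coordField φ V y) = V (φ y) :=
  (isInvertible_mfderiv_of_mem_maximalAtlas hφ hy).self_apply_inverse _

theorem coordField_mfderiv (hφ : φ ∈ IsManifold.maximalAtlas (𝓡 n) ∞ M) (hy : y ∈ φ.source)
    (v : TangentSpace (𝓡 n) y) :
    coordField φ (fun _ ↦ mfderiv (𝓡 n) 𝓘(ℝ, EuclideanSpace ℝ (Fin n)) φ y v) y = v :=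
  (isInvertible_mfderiv_of_mem_maximalAtlas hφ hy).inverse_apply_self v

variable [IsManifold (𝓡 n) ∞ M]

theorem smoothAt_coordField (hφ : φ ∈ IsManifold.maximalAtlas (𝓡 n) ∞ M) (hy : y ∈ φ.source)
    (hV : ContDiffAt ℝ ∞ V (φ y)) : SmoothAt (coordField φ V) y :=
  ContMDiffAt.mpullback_vectorField_preimage (n := ∞) (m := ∞)
    (contMDiffAt_vectorSpace_iff_contDiffAt.2 hV) (contMDiffAt_of_mem_maximalAtlas hφ hy)
    (isInvertible_mfderiv_of_mem_maximalAtlas hφ hy) (by simp)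

theorem mlieBracket_coordField_const (hφ : φ ∈ IsManifold.maximalAtlas (𝓡 n) ∞ M)
    (hy : y ∈ φ.source) (a b : EuclideanSpace ℝ (Fin n)) :
    mlieBracket (𝓡 n) (coordField φ fun _ ↦ a) (coordField φ fun _ ↦ b) y = 0 := by
  have : IsManifold (𝓡 n) (minSmoothness ℝ 2) M := by
    rw [minSmoothness_of_isRCLikeNormedField]
    infer_instance
  have mdiff (c : EuclideanSpace ℝ (Fin n)) :
      MDifferentiableAt 𝓘(ℝ, EuclideanSpace ℝ (Fin n)) 𝓘(ℝ, EuclideanSpace ℝ (Fin n)).tangent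
        (fun z ↦ (⟨z, c⟩ : TangentBundle 𝓘(ℝ, EuclideanSpace ℝ (Fin n)) _)) (φ y) :=
    (contMDiffAt_vectorSpace_iff_contDiffAt (n := 1).2 contDiffAt_const).mdifferentiableAt
      one_ne_zero
  unfold coordField
  rw [← VectorField.mpullback_mlieBracket (mdiff a) (mdiff b)
    (contMDiffAt_of_mem_maximalAtlas hφ hy) (by
      rw [minSmoothness_of_isRCLikeNormedField]
      exact ENat.LEInfty.out), VectorField.mpullback_apply]
  exact (congrArg _ (mlieBracket_const a b (φ y))).trans (map_zero _)

theorem SmoothAt.exists_eventuallyEq_coordField {Y : VField n M} (hY : SmoothAt Y y)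
    (hφ : φ ∈ IsManifold.maximalAtlas (𝓡 n) ∞ M) (hy : y ∈ φ.source) :
    ∃ V : EuclideanSpace ℝ (Fin n) → EuclideanSpace ℝ (Fin n),
      ContDiffAt ℝ ∞ V (φ y) ∧ Y =ᶠ[𝓝 y] coordField φ V := by
  have hφ' := mdifferentiable_of_mem_maximalAtlas hφ
  have deriv_symm_comp_deriv {w} (hw : w ∈ φ.target) :
      (mfderiv 𝓘(ℝ, EuclideanSpace ℝ (Fin n)) (𝓡 n) φ.symm w).comp
        (mfderiv (𝓡 n) 𝓘(ℝ, EuclideanSpace ℝ (Fin n)) φ (φ.symm w)) = .id ℝ _ := by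
    have comp_eq := hφ'.symm_comp_deriv (φ.map_target hw)
    rwa [φ.right_inv hw] at comp_eq
  have inverse_eq {w} (hw : w ∈ φ.target) :
      (mfderiv 𝓘(ℝ, EuclideanSpace ℝ (Fin n)) (𝓡 n) φ.symm w).inverse =
        mfderiv (𝓡 n) 𝓘(ℝ, EuclideanSpace ℝ (Fin n)) φ (φ.symm w) :=
    ContinuousLinearMap.inverse_eq (deriv_symm_comp_deriv hw) (hφ'.comp_symm_deriv hw)
  refine ⟨VectorField.mpullback 𝓘(ℝ, EuclideanSpace ℝ (Fin n)) (𝓡 n) φ.symm Y, ?_, ?_⟩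
  · rw [← contMDiffAt_vectorSpace_iff_contDiffAt]
    refine ContMDiffAt.mpullback_vectorField_preimage (n := ∞) (m := ∞) ?_ ?_ ?_ (by simp)
    · rwa [φ.left_inv hy]
    · exact contMDiffAt_symm_of_mem_maximalAtlas hφ (φ.map_source hy)
    · exact .of_inverse (deriv_symm_comp_deriv (φ.map_source hy))
        (hφ'.comp_symm_deriv (φ.map_source hy))
  · filter_upwards [φ.open_source.mem_nhds hy] with z hz
    obtain ⟨w, hw, rfl⟩ : ∃ w ∈ φ.target, φ.symm w = z :=
      ⟨φ z, φ.map_source hz, φ.left_inv hz⟩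
    unfold coordField
    rw [VectorField.mpullback_apply, φ.right_inv hw, VectorField.mpullback_apply, inverse_eq hw]
    exact ((isInvertible_mfderiv_of_mem_maximalAtlas hφ hz).inverse_apply_self _).symm

end CoordinateFields

section SliceCharts

variable {n : ℕ} {M : Type*} [TopologicalSpace M] [ChartedSpace (EuclideanSpace ℝ (Fin n)) M]
  {N : Type*} [TopologicalSpace N] [ChartedSpace (EuclideanSpace ℝ (Fin (n - 1))) N]
  {ι : N → M} {p y : N}

/-- Charts around `p` and `ι p` in which `ι` is a linear map `L` with a left inverse `π`. -/
structure SliceCharts (n : ℕ) {M : Type*} [TopologicalSpace M]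
    [ChartedSpace (EuclideanSpace ℝ (Fin n)) M]
    {N : Type*} [TopologicalSpace N] [ChartedSpace (EuclideanSpace ℝ (Fin (n - 1))) N]
    (ι : N → M) (p : N) where
  /-- the chart of the surface -/
  dom : OpenPartialHomeomorph N (EuclideanSpace ℝ (Fin (n - 1)))
  /-- the chart of the space-time -/
  cod : OpenPartialHomeomorph M (EuclideanSpace ℝ (Fin n))
  /-- the map `ι` in the charts -/
  L : EuclideanSpace ℝ (Fin (n - 1)) →L[ℝ] EuclideanSpace ℝ (Fin n)
  /-- a left inverse of `L` -/
  π : EuclideanSpace ℝ (Fin n) →L[ℝ] EuclideanSpace ℝ (Fin (n - 1))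
  dom_mem : dom ∈ IsManifold.maximalAtlas (𝓡 (n - 1)) ∞ N
  cod_mem : cod ∈ IsManifold.maximalAtlas (𝓡 n) ∞ M
  mem_dom : p ∈ dom.source
  mem_cod : ∀ y ∈ dom.source, ι y ∈ cod.source
  apply : ∀ y ∈ dom.source, cod (ι y) = L (dom y)
  left_inv : ∀ a, π (L a) = a

theorem nonempty_sliceCharts (hι : Manifold.IsImmersion (𝓡 (n - 1)) (𝓡 n) ∞ ι) (p : N) :
    Nonempty (SliceCharts n ι p) := by
  have h := hι.isImmersionAt p
  refine ⟨⟨h.domChart, h.codChart,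
    h.equiv.toContinuousLinearMap ∘L ContinuousLinearMap.inl ℝ _ _,
    ContinuousLinearMap.fst ℝ _ _ ∘L h.equiv.symm.toContinuousLinearMap,
    h.domChart_mem_maximalAtlas, h.codChart_mem_maximalAtlas, h.mem_domChart_source,
    fun y hy ↦ h.source_subset_preimage_source hy, fun y hy ↦ ?_, fun a ↦ by simp⟩⟩
  have mem_target : h.domChart y ∈ (h.domChart.extend (𝓡 (n - 1))).target := by
    simp [h.domChart.map_source hy]
  simpa [h.domChart.left_inv hy] using h.writtenInCharts mem_target

namespace SliceCharts

variable (s : SliceCharts n ι p)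

theorem eventually_mem_dom : ∀ᶠ y in 𝓝 p, y ∈ s.dom.source :=
  s.dom.open_source.mem_nhds s.mem_dom

theorem mfderiv_cod_push (hι : ContMDiff (𝓡 (n - 1)) (𝓡 n) ∞ ι) (hy : y ∈ s.dom.source)
    (u : TangentSpace (𝓡 (n - 1)) y) :
    mfderiv (𝓡 n) 𝓘(ℝ, EuclideanSpace ℝ (Fin n)) s.cod (ι y) (push ι y u) =
      s.L (mfderiv (𝓡 (n - 1)) 𝓘(ℝ, EuclideanSpace ℝ (Fin (n - 1))) s.dom y u) := by
  have mdiff_cod :=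
    (mdifferentiable_of_mem_maximalAtlas s.cod_mem).mdifferentiableAt (s.mem_cod y hy)
  have mdiff_dom := (mdifferentiable_of_mem_maximalAtlas s.dom_mem).mdifferentiableAt hy
  have comp_eq : s.cod ∘ ι =ᶠ[𝓝 y] s.L ∘ s.dom := by
    filter_upwards [s.dom.open_source.mem_nhds hy] with z hz
    exact s.apply z hz
  have deriv_comp_eq := comp_eq.mfderiv_eq (I := 𝓡 (n - 1)) (I' := 𝓘(ℝ, EuclideanSpace ℝ (Fin n)))
  rw [mfderiv_comp y mdiff_cod ((hι y).mdifferentiableAt (by simp)),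
    mfderiv_comp y s.L.mdifferentiableAt mdiff_dom, ContinuousLinearMap.mfderiv_eq] at deriv_comp_eq
  exact congrArg (fun T : EuclideanSpace ℝ (Fin (n - 1)) →L[ℝ] EuclideanSpace ℝ (Fin n) ↦ T u)
    deriv_comp_eq

/-- The vector field on the surface with components `V`. -/
def field (V : EuclideanSpace ℝ (Fin (n - 1)) → EuclideanSpace ℝ (Fin (n - 1))) :
    VField (n - 1) N :=
  coordField s.dom V

/-- The extension of `s.field V` to the space-time which is constant along the fibres of `π`. -/
def extendedField (V : EuclideanSpace ℝ (Fin (n - 1)) → EuclideanSpace ℝ (Fin (n - 1))) :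
    VField n M :=
  coordField s.cod fun a ↦ s.L (V (s.π a))

variable {V : EuclideanSpace ℝ (Fin (n - 1)) → EuclideanSpace ℝ (Fin (n - 1))}

theorem extendedField_apply (hι : ContMDiff (𝓡 (n - 1)) (𝓡 n) ∞ ι) (hy : y ∈ s.dom.source) :
    s.extendedField V (ι y) = push ι y (s.field V y) := by
  apply (mdifferentiable_of_mem_maximalAtlas s.cod_mem).mfderiv_injective (s.mem_cod y hy)
  refine (mfderiv_coordField s.cod_mem (s.mem_cod y hy)).trans ?_
  rw [s.mfderiv_cod_push hι hy, s.apply y hy, s.left_inv]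
  exact congrArg s.L (mfderiv_coordField s.dom_mem hy).symm

end SliceCharts

theorem push_injective (hι : Manifold.IsImmersion (𝓡 (n - 1)) (𝓡 n) ∞ ι) (p : N) :
    Function.Injective (push (n := n) ι p) := by
  obtain ⟨s⟩ := nonempty_sliceCharts hι p
  intro u v push_eq
  have deriv_eq := s.mfderiv_cod_push hι.contMDiff s.mem_dom u
  rw [push_eq, s.mfderiv_cod_push hι.contMDiff s.mem_dom v] at deriv_eq
  exact ((mdifferentiable_of_mem_maximalAtlas s.dom_mem).mfderiv_injective s.mem_dom
    (Function.LeftInverse.injective s.left_inv deriv_eq)).symm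

variable [IsManifold (𝓡 n) ∞ M]

theorem SliceCharts.isExtensionAt_field (s : SliceCharts n ι p)
    {V : EuclideanSpace ℝ (Fin (n - 1)) → EuclideanSpace ℝ (Fin (n - 1))}
    (hι : ContMDiff (𝓡 (n - 1)) (𝓡 n) ∞ ι) (hy : y ∈ s.dom.source)
    (hV : ContDiffAt ℝ ∞ V (s.dom y)) : IsExtensionAt ι y (s.field V) (s.extendedField V) where
  smooth := by
    refine smoothAt_coordField s.cod_mem (s.mem_cod y hy) ?_
    refine s.L.contDiff.contDiffAt.comp _ (ContDiffAt.comp _ ?_ s.π.contDiff.contDiffAt)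
    rwa [s.apply y hy, s.left_inv]
  extends_near := by
    filter_upwards [s.dom.open_source.mem_nhds hy] with z hz
    exact s.extendedField_apply hι hz

variable [IsManifold (𝓡 (n - 1)) ∞ N]

theorem SmoothAt.exists_isExtensionAt {Y : VField (n - 1) N} (hY : SmoothAt Y p)
    (hι : Manifold.IsImmersion (𝓡 (n - 1)) (𝓡 n) ∞ ι) :
    ∃ Y' : VField n M, IsExtensionAt ι p Y Y' := by
  obtain ⟨s⟩ := nonempty_sliceCharts hι p
  obtain ⟨V, hV, Y_eq⟩ := hY.exists_eventuallyEq_coordField s.dom_mem s.mem_dom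
  have field_ext := s.isExtensionAt_field hι.contMDiff s.mem_dom hV
  refine ⟨s.extendedField V, field_ext.smooth, ?_⟩
  filter_upwards [Y_eq, field_ext.extends_near] with y hy extends_y
  rw [extends_y, hy, SliceCharts.field]

end SliceCharts

section Induced

variable {n : ℕ} {M : Type*} [TopologicalSpace M] [ChartedSpace (EuclideanSpace ℝ (Fin n)) M]
  [IsManifold (𝓡 n) ∞ M]
  {N : Type*} [TopologicalSpace N] [ChartedSpace (EuclideanSpace ℝ (Fin (n - 1))) N]
  {ι : N → M} {p : N} {g : LorentzMetric n M}

/-- The induced metric tensor `q` as a field of bilinear forms. -/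
def inducedForm (ι : N → M) (g : LorentzMetric n M) (p : N) :
    LinearMap.BilinForm ℝ (TangentSpace (𝓡 (n - 1)) p) :=
  LinearMap.mk₂ ℝ (inducedMetric ι g p) (by simp [inducedMetric]) (by simp [inducedMetric])
    (by simp [inducedMetric]) (by simp [inducedMetric])

theorem inducedForm_apply (u v : TangentSpace (𝓡 (n - 1)) p) :
    inducedForm ι g p u v = g.val (ι p) (push ι p u) (push ι p v) := rfl

theorem InNullDirection.of_inducedForm_eq {M' : Type*} [TopologicalSpace M']
    [ChartedSpace (EuclideanSpace ℝ (Fin n)) M'] [IsManifold (𝓡 n) ∞ M'] {g' : LorentzMetric n M'}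
    {ι' : N → M'} {l : TangentSpace (𝓡 (n - 1)) p} (hl : InNullDirection g ι p l)
    (hq : inducedForm ι g = inducedForm ι' g') : InNullDirection g' ι' p l :=
  fun w ↦ (LinearMap.congr_fun₂ (congrFun hq p) l w).symm.trans (hl w)

theorem metric_push_ne_zero (hι : Manifold.IsImmersion (𝓡 (n - 1)) (𝓡 n) ∞ ι)
    {l : TangentSpace (𝓡 (n - 1)) p} (hl : l ≠ 0) : g.val (ι p) (push ι p l) ≠ 0 := by
  intro val_eq
  refine hl (push_injective hι p ?_)
  rw [map_zero]
  refine LorentzMetric.eq_zero_of_orthogonal (g := g) fun w ↦ ?_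
  rw [g.symm, val_eq, zero_apply]

theorem InNullDirection.ker_eq_range (hι : Manifold.IsImmersion (𝓡 (n - 1)) (𝓡 n) ∞ ι)
    {l : TangentSpace (𝓡 (n - 1)) p} (hl : InNullDirection g ι p l) (hl₀ : l ≠ 0) :
    LinearMap.ker (g.val (ι p) (push ι p l)).toLinearMap =
      LinearMap.range (push (n := n) ι p).toLinearMap := by
  symm
  refine Submodule.eq_of_le_of_finrank_eq ?_ ?_
  · rintro _ ⟨w, rfl⟩
    exact hl w
  have finrank_ker := Module.Dual.finrank_ker_add_one_of_ne_zero
    (f := (g.val (ι p) (push ι p l)).toLinearMap)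
    fun h ↦ metric_push_ne_zero hι hl₀ (ContinuousLinearMap.coe_injective h)
  have finrank_M : Module.finrank ℝ (TangentSpace (𝓡 n) (ι p)) = n := finrank_euclideanSpace_fin
  have finrank_N : Module.finrank ℝ (TangentSpace (𝓡 (n - 1)) p) = n - 1 :=
    finrank_euclideanSpace_fin
  rw [LinearMap.finrank_range_of_inj (push_injective hι p)]
  omega

theorem InNullDirection.exists_eq_smul (hι : Manifold.IsImmersion (𝓡 (n - 1)) (𝓡 n) ∞ ι)
    {l w : TangentSpace (𝓡 (n - 1)) p} (hl : InNullDirection g ι p l) (hl₀ : l ≠ 0)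
    (hw : InNullDirection g ι p w) : ∃ c : ℝ, w = c • l := by
  have ker_le : LinearMap.ker (g.val (ι p) (push ι p l)).toLinearMap ≤
      LinearMap.ker (g.val (ι p) (push ι p w)).toLinearMap := by
    rw [hl.ker_eq_range hι hl₀]
    rintro _ ⟨z, rfl⟩
    exact hw z
  have mem_span := mem_span_of_iInf_ker_le_ker
    (L := fun _ : Unit ↦ (g.val (ι p) (push ι p l)).toLinearMap) ((iInf_const).trans_le ker_le)
  rw [Set.range_const, Submodule.mem_span_singleton] at mem_span
  obtain ⟨c, hc⟩ := mem_span
  refine ⟨c, push_injective hι p (sub_eq_zero.1 ?_)⟩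
  refine LorentzMetric.eq_zero_of_orthogonal (g := g) fun z ↦ ?_
  rw [g.symm, map_sub, map_smul, map_smul, sub_apply, sub_eq_zero]
  exact (LinearMap.congr_fun hc z).symm

variable [IsManifold (𝓡 (n - 1)) ∞ N] {nabla : Connection n M} {D : Connection (n - 1) N}

theorem exists_commuting_extensions (hι : Manifold.IsImmersion (𝓡 (n - 1)) (𝓡 n) ∞ ι) (p : N) :
    ∃ (X : TangentSpace (𝓡 (n - 1)) p → VField (n - 1) N)
      (X' : TangentSpace (𝓡 (n - 1)) p → VField n M),
      (∀ u, X u p = u) ∧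
      (∀ u, ∀ᶠ y in 𝓝 p, SmoothAt (X u) y ∧ IsExtensionAt ι y (X u) (X' u)) ∧
      (∀ u v, mlieBracket (𝓡 (n - 1)) (X u) (X v) p = 0) ∧
      ∀ u v, mlieBracket (𝓡 n) (X' u) (X' v) (ι p) = 0 := by
  obtain ⟨s⟩ := nonempty_sliceCharts hι p
  refine ⟨fun u ↦ s.field fun _ ↦ mfderiv (𝓡 (n - 1)) (𝓡 (n - 1)) s.dom p u,
    fun u ↦ s.extendedField fun _ ↦ mfderiv (𝓡 (n - 1)) (𝓡 (n - 1)) s.dom p u,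
    fun u ↦ coordField_mfderiv s.dom_mem s.mem_dom u, fun u ↦ ?_,
    fun u v ↦ mlieBracket_coordField_const s.dom_mem s.mem_dom _ _,
    fun u v ↦ mlieBracket_coordField_const s.cod_mem (s.mem_cod p s.mem_dom) _ _⟩
  filter_upwards [s.eventually_mem_dom] with y hy
  exact ⟨smoothAt_coordField s.dom_mem hy contDiffAt_const,
    s.isExtensionAt_field hι.contMDiff hy contDiffAt_const⟩

namespace IsInducedConnection

theorem torsion_eq_zero (h : IsInducedConnection nabla ι D)
    (hι : Manifold.IsImmersion (𝓡 (n - 1)) (𝓡 n) ∞ ι) (hT : nabla.torsion = 0) :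
    D.torsion = 0 := by
  ext p u v : 3
  obtain ⟨X, X', X_apply, X_near, bracket, bracket'⟩ := exists_commuting_extensions hι p
  have smooth_X (w) : SmoothAt (X w) p := (X_near w).self_of_nhds.1
  have extends_X (w) : IsExtensionAt ι p (X w) (X' w) := (X_near w).self_of_nhds.2
  have comm := Connection.apply_comm_of_torsion_eq_zero hT (extends_X u).smooth.diffAt
    (extends_X v).smooth.diffAt
  rw [bracket', add_zero, (extends_X u).extends_near.self_of_nhds,
    (extends_X v).extends_near.self_of_nhds, ← h.eq p _ _ (smooth_X u) (extends_X u),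
    ← h.eq p _ _ (smooth_X v) (extends_X v)] at comm
  have torsion_apply := D.torsion_apply (smooth_X u).diffAt (smooth_X v).diffAt
  rwa [push_injective hι p comm, bracket, sub_self, sub_zero, X_apply, X_apply] at torsion_apply

theorem isExtensionAt_along (h : IsInducedConnection nabla ι D) (hnabla : nabla.IsSmooth)
    {X Y : VField (n - 1) N} {X' Y' : VField n M} (hX : IsExtensionAt ι p X X')
    (hY : ∀ᶠ y in 𝓝 p, SmoothAt Y y ∧ IsExtensionAt ι y Y Y') :
    IsExtensionAt ι p (D.along X Y) (nabla.along X' Y') where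
  smooth := hnabla _ _ _ hX.smooth hY.self_of_nhds.2.smooth
  extends_near := by
    filter_upwards [hX.extends_near, hY] with y extends_X hY
    rw [Connection.along, Connection.along, h.eq y Y Y' hY.1 hY.2, extends_X]

theorem push_curvatureAt (h : IsInducedConnection nabla ι D)
    (hι : Manifold.IsImmersion (𝓡 (n - 1)) (𝓡 n) ∞ ι) (hnabla : nabla.IsSmooth)
    (u v w : TangentSpace (𝓡 (n - 1)) p) :
    push ι p (curvatureAt D p u v w) =
      curvatureAt nabla (ι p) (push ι p u) (push ι p v) (push ι p w) := by
  obtain ⟨X, X', X_apply, X_near, bracket, bracket'⟩ := exists_commuting_extensions hι p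
  have smooth_X (w) : SmoothAt (X w) p := (X_near w).self_of_nhds.1
  have extends_X (w) : IsExtensionAt ι p (X w) (X' w) := (X_near w).self_of_nhds.2
  have X'_apply (w) : X' w (ι p) = push ι p w := by
    rw [(extends_X w).extends_near.self_of_nhds, X_apply]
  have second_derivative (a b c) :
      push ι p (D (D.along (X a) (X b)) p c) =
        nabla (nabla.along (X' a) (X' b)) (ι p) (push ι p c) :=
    h.eq p _ _ (h.smooth _ _ _ (smooth_X a) (smooth_X b))
      (h.isExtensionAt_along hnabla (extends_X a) (X_near b)) c
  have curvature_eq := curvature_eq_curvatureAt h.smooth (smooth_X u) (smooth_X v) (smooth_X w)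
  have curvature_eq' := curvature_eq_curvatureAt hnabla (extends_X u).smooth (extends_X v).smooth
    (extends_X w).smooth
  simp only [X_apply, X'_apply, curvature, bracket, bracket', map_zero, sub_zero]
    at curvature_eq curvature_eq'
  rw [← curvature_eq, ← curvature_eq', map_sub, second_derivative, second_derivative]

theorem preserves_inducedForm (h : IsInducedConnection nabla ι D)
    (hι : Manifold.IsImmersion (𝓡 (n - 1)) (𝓡 n) ∞ ι) (hLC : IsLeviCivita g nabla) :
    D.Preserves (inducedForm ι g) := by
  intro p Y Z hY hZ u
  obtain ⟨Y', hY'⟩ := hY.exists_isExtensionAt hι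
  obtain ⟨Z', hZ'⟩ := hZ.exists_isExtensionAt hι
  have pullback_eq : (fun y ↦ inducedForm ι g y (Y y) (Z y)) =ᶠ[𝓝 p]
      (fun z ↦ g.val z (Y' z) (Z' z)) ∘ ι := by
    filter_upwards [hY'.extends_near, hZ'.extends_near] with y extends_Y extends_Z
    simp only [inducedForm_apply, Function.comp, extends_Y, extends_Z]
  have mvfderiv_eq : mvfderiv (𝓡 (n - 1)) (fun y ↦ inducedForm ι g y (Y y) (Z y)) p =
      mvfderiv (𝓡 (n - 1)) ((fun z ↦ g.val z (Y' z) (Z' z)) ∘ ι) p := by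
    simp only [mvfderiv, pullback_eq.mfderiv_eq]
    rfl
  rw [mvfderiv_eq, mvfderiv_comp_apply (I := 𝓡 n) p
      ((LorentzMetric.contMDiffAt_apply hY'.smooth hZ'.smooth).mdifferentiableAt (by simp))
      ((hι.contMDiff p).mdifferentiableAt (by simp)) u,
    hLC.metric _ Y' Z' hY'.smooth.diffAt hZ'.smooth.diffAt, hY'.extends_near.self_of_nhds,
    hZ'.extends_near.self_of_nhds, ← h.eq p Y Y' hY hY', ← h.eq p Z Z' hZ hZ', inducedForm_apply,
    inducedForm_apply]

end IsInducedConnection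

theorem IsInducedConnection.ricci_push (h : IsInducedConnection nabla ι D)
    (hι : Manifold.IsImmersion (𝓡 (n - 1)) (𝓡 n) ∞ ι) (hLC : IsLeviCivita g nabla)
    {l : TangentSpace (𝓡 (n - 1)) p} (hl : InNullDirection g ι p l) (hl₀ : l ≠ 0)
    {v w : TangentSpace (𝓡 (n - 1)) p} {c : ℝ} (hc : curvatureAt D p l w v = c • l) :
    ricci nabla (ι p) (push ι p v) (push ι p w) = ricci D p v w + c := by
  obtain ⟨k, hk⟩ := LinearMap.surjective (f := (g.val (ι p) (push ι p l)).toLinearMap)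
    (fun h ↦ metric_push_ne_zero hι hl₀ (ContinuousLinearMap.coe_injective h)) 1
  rw [ricci_eq_trace hLC.smooth, ricci_eq_trace h.smooth, trace_eq_trace_add_of_intertwines
    (push_injective hι p) (hl.ker_eq_range hι hl₀) hk
    (B := curvatureMap h.smooth p v w)
    (LinearMap.ext fun u ↦ (h.push_curvatureAt hι hLC.smooth u v w).symm)]
  congr 1
  change g.val (ι p) (push ι p l) (curvatureAt nabla (ι p) k (push ι p v) (push ι p w)) = c
  rw [g.symm, hLC.metric_curvatureAt_pair_symm, hLC.metric_curvatureAt_swap, curvatureAt_swap,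
    ← h.push_curvatureAt hι hLC.smooth, hc]
  simpa using congrArg (c * ·) hk

end Induced

section Recurrent

variable {n : ℕ} {N : Type*} [TopologicalSpace N]
  [ChartedSpace (EuclideanSpace ℝ (Fin (n - 1))) N] [IsManifold (𝓡 (n - 1)) ∞ N]
  {D : Connection (n - 1) N} {ℓ X Y V : VField (n - 1) N}
  {rot : Π p : N, TangentSpace (𝓡 (n - 1)) p →L[ℝ] ℝ} {f : N → ℝ} {p : N}

theorem contMDiffAt_of_smul (hℓ : SmoothAt ℓ p) (hℓ₀ : ℓ p ≠ 0) (hfℓ : SmoothAt (f • ℓ) p) :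
    ContMDiffAt (𝓡 (n - 1)) 𝓘(ℝ, ℝ) ∞ f p := by
  let t := trivializationAt (EuclideanSpace ℝ (Fin (n - 1)))
    (TangentSpace (𝓡 (n - 1)) : N → Type _) p
  have hp : p ∈ t.baseSet := FiberBundle.mem_baseSet_trivializationAt _ _ p
  let b := Module.Basis.ofVectorSpace ℝ (EuclideanSpace ℝ (Fin (n - 1)))
  let c := t.localFrameCoeff (𝓡 (n - 1)) b
  obtain ⟨i, hi⟩ : ∃ i, c i p (ℓ p) ≠ 0 := by
    contrapose! hℓ₀
    rw [(t.eventually_eq_localFrame_sum_coeff_smul (I := 𝓡 (n - 1)) (s := ℓ) b hp).self_of_nhds]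
    exact Finset.sum_eq_zero fun i _ ↦ (congrArg (· • _) (hℓ₀ i)).trans (zero_smul ℝ _)
  have smooth_coeff : ContMDiffAt (𝓡 (n - 1)) 𝓘(ℝ, ℝ) ∞ (fun y ↦ c i y (ℓ y)) p :=
    contMDiffAt_localFrameCoeff b hp hℓ i
  have smooth_quotient : ContMDiffAt (𝓡 (n - 1)) 𝓘(ℝ, ℝ) ∞
      (fun y ↦ c i y ((f • ℓ) y) / c i y (ℓ y)) p :=
    (contMDiffAt_localFrameCoeff b hp hfℓ i).div₀ smooth_coeff hi
  refine smooth_quotient.congr_of_eventuallyEq ?_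
  filter_upwards [smooth_coeff.continuousAt.eventually_ne hi] with y hy
  rw [Pi.smul_apply', map_smul, smul_eq_mul, mul_div_cancel_right₀ _ hy]

/-- The nowhere vanishing smooth field `ℓ` is recurrent: `D ℓ = rot ⊗ ℓ`. -/
structure IsRecurrent (D : Connection (n - 1) N) (ℓ : VField (n - 1) N)
    (rot : Π p : N, TangentSpace (𝓡 (n - 1)) p →L[ℝ] ℝ) : Prop where
  smooth : ∀ p, SmoothAt ℓ p
  ne_zero : ∀ p, ℓ p ≠ 0
  rotation : IsRotationPotential D ℓ rot

/-- The flow of `ℓ` preserves the connection: `[L_ℓ, D] = 0`. -/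
def IsAffineField (D : Connection (n - 1) N) (ℓ : VField (n - 1) N) : Prop :=
  ∀ (p : N) (X Y : VField (n - 1) N), SmoothAt X p → SmoothAt Y p → lieConnection D ℓ X Y p = 0

/-- The bilinear form given by `R(ℓ, v) w = flowCurvature D rot p v w • ℓ` for an affine field `ℓ`
that is recurrent with rotation potential `rot`. In this form it does not involve `ℓ`. -/
def flowCurvature (D : Connection (n - 1) N) (rot : Π p : N, TangentSpace (𝓡 (n - 1)) p →L[ℝ] ℝ)
    (p : N) (v w : TangentSpace (𝓡 (n - 1)) p) : ℝ :=
  rot p (D (localExtension w) p v) -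
    mvfderiv (𝓡 (n - 1)) (fun y ↦ rot y (localExtension w y)) p v - rot p w * rot p v

namespace IsRecurrent

theorem along_eq_smul (h : IsRecurrent D ℓ rot) (Y : VField (n - 1) N) :
    D.along Y ℓ = (fun y ↦ rot y (Y y)) • ℓ :=
  funext fun y ↦ h.rotation y (Y y)

theorem rot_apply_ne_zero (h : IsRecurrent D ℓ rot) (hκ : IsNonExtremal D ℓ) (p : N) :
    rot p (ℓ p) ≠ 0 := by
  obtain ⟨κ, κ_ne_zero, hκ⟩ := hκ p
  rw [h.rotation] at hκ
  rwa [smul_left_injective ℝ (h.ne_zero p) hκ]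

theorem contMDiffAt_rot (h : IsRecurrent D ℓ rot) (hD : D.IsSmooth) (hY : SmoothAt Y p) :
    ContMDiffAt (𝓡 (n - 1)) 𝓘(ℝ, ℝ) ∞ (fun y ↦ rot y (Y y)) p :=
  contMDiffAt_of_smul (h.smooth p) (h.ne_zero p)
    (h.along_eq_smul Y ▸ hD p Y ℓ hY (h.smooth p))

theorem apply_along (h : IsRecurrent D ℓ rot) (hD : D.IsSmooth) (hY : SmoothAt Y p)
    (u : TangentSpace (𝓡 (n - 1)) p) :
    D (D.along Y ℓ) p u =
      (mvfderiv (𝓡 (n - 1)) (fun y ↦ rot y (Y y)) p u + rot p (Y p) * rot p u) • ℓ p := by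
  rw [h.along_eq_smul, D.smul_apply ((h.contMDiffAt_rot hD hY).mdifferentiableAt (by simp))
    (h.smooth p).diffAt, h.rotation p u]
  module

theorem apply_mem_span (h : IsRecurrent D ℓ rot) (hV : SmoothAt V p)
    (V_mem : ∀ᶠ y in 𝓝 p, V y ∈ ℝ ∙ ℓ y) (u : TangentSpace (𝓡 (n - 1)) p) :
    D V p u ∈ ℝ ∙ ℓ p := by
  obtain ⟨f, hf⟩ := (V_mem.mono fun y hy ↦ Submodule.mem_span_singleton.1 hy).choice
  have smooth_fℓ : SmoothAt (f • ℓ) p := hV.congr hf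
  have smooth_f := contMDiffAt_of_smul (h.smooth p) (h.ne_zero p) smooth_fℓ
  rw [← D.congr_of_eventually smooth_fℓ.diffAt hV.diffAt hf,
    D.smul_apply (smooth_f.mdifferentiableAt (by simp)) (h.smooth p).diffAt, h.rotation,
    smul_smul, ← add_smul]
  exact Submodule.smul_mem _ _ (Submodule.mem_span_singleton_self _)

theorem curvatureAt_mem_span (h : IsRecurrent D ℓ rot) (hD : D.IsSmooth)
    (u v : TangentSpace (𝓡 (n - 1)) p) : curvatureAt D p u v (ℓ p) ∈ ℝ ∙ ℓ p := by
  have apply_mem (y : N) (w : TangentSpace (𝓡 (n - 1)) y) : D ℓ y w ∈ ℝ ∙ ℓ y :=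
    Submodule.mem_span_singleton.2 ⟨rot y w, (h.rotation y w).symm⟩
  have along_mem {X : VField (n - 1) N} (hX : SmoothAt X p) (w : TangentSpace (𝓡 (n - 1)) p) :
      D (D.along X ℓ) p w ∈ ℝ ∙ ℓ p :=
    h.apply_mem_span (hD p X ℓ hX (h.smooth p)) (.of_forall fun y ↦ apply_mem y (X y)) w
  have hX := smoothAt_localExtension u
  have hY := smoothAt_localExtension v
  have curvature_eq := curvature_eq_curvatureAt hD hX hY (h.smooth p)
  rw [localExtension_apply_self, localExtension_apply_self] at curvature_eq
  rw [← curvature_eq]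
  exact sub_mem (sub_mem (along_mem hY _) (along_mem hX _)) (apply_mem p _)

theorem curvatureAt_flow (h : IsRecurrent D ℓ rot) (hD : D.IsSmooth) (hT : D.torsion = 0)
    (hℓ : IsAffineField D ℓ) (hX : SmoothAt X p) (hY : SmoothAt Y p) :
    curvatureAt D p (ℓ p) (X p) (Y p) =
      (rot p (D Y p (X p)) - mvfderiv (𝓡 (n - 1)) (fun y ↦ rot y (Y y)) p (X p) -
        rot p (Y p) * rot p (X p)) • ℓ p := by
  have smooth_ℓ := h.smooth p
  have affine := hℓ p X Y hX hY
  have comm := Connection.apply_comm_of_torsion_eq_zero hT smooth_ℓ.diffAt (hD p X Y hX hY).diffAt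
  have comm_along := Connection.apply_along_comm_of_torsion_eq_zero hD hT hX smooth_ℓ hY
  have comm_bracket :=
    Connection.apply_comm_of_torsion_eq_zero hT hX.diffAt (smooth_ℓ.mlieBracket hY).diffAt
  rw [lieConnection] at affine
  rw [add_assoc, ← comm_bracket] at comm_along
  rw [← curvature_eq_curvatureAt hD smooth_ℓ hX hY, curvature, comm, comm_along,
    h.apply_along hD hY, h.rotation, ← sub_eq_zero, ← affine]
  simp only [Connection.along]
  module

theorem curvatureAt_eq_flowCurvature_smul (h : IsRecurrent D ℓ rot) (hD : D.IsSmooth)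
    (hT : D.torsion = 0) (hℓ : IsAffineField D ℓ) {l : TangentSpace (𝓡 (n - 1)) p}
    (hl : l ∈ ℝ ∙ ℓ p) (v w : TangentSpace (𝓡 (n - 1)) p) :
    curvatureAt D p l v w = flowCurvature D rot p v w • l := by
  obtain ⟨c, rfl⟩ := Submodule.mem_span_singleton.1 hl
  have curvatureAt_flow := h.curvatureAt_flow hD hT hℓ
    (smoothAt_localExtension v) (smoothAt_localExtension w)
  rw [localExtension_apply_self, localExtension_apply_self] at curvatureAt_flow
  rw [curvatureAt_smul_left hD, curvatureAt_flow, smul_comm, flowCurvature]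

theorem ricci_apply_flow (h : IsRecurrent D ℓ rot) (hD : D.IsSmooth) (hT : D.torsion = 0)
    (hℓ : IsAffineField D ℓ) (v : TangentSpace (𝓡 (n - 1)) p) :
    ricci D p v (ℓ p) = -mvfderiv (𝓡 (n - 1)) (fun y ↦ rot y (ℓ y)) p v := by
  have curvatureAt_flow := h.curvatureAt_flow hD hT hℓ (smoothAt_localExtension v) (h.smooth p)
  rw [localExtension_apply_self] at curvatureAt_flow
  rw [ricci_eq_trace hD]
  refine trace_eq_of_range_le_span (h.ne_zero p) ?_ ?_
  · rintro _ ⟨u, rfl⟩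
    exact h.curvatureAt_mem_span hD u v
  · rw [curvatureMap_apply, curvatureAt_flow, h.rotation, map_smul, smul_eq_mul]
    congr 1
    ring

theorem of_smul (h : IsRecurrent D (f • ℓ) rot) (hℓ : ∀ p, SmoothAt ℓ p) (hℓ₀ : ∀ p, ℓ p ≠ 0)
    (df_eq_zero : ∀ p, mvfderiv (𝓡 (n - 1)) f p = 0) : IsRecurrent D ℓ rot where
  smooth := hℓ
  ne_zero := hℓ₀
  rotation p v := by
    have f_ne_zero : f p ≠ 0 := fun hf ↦ h.ne_zero p (by rw [Pi.smul_apply', hf, zero_smul])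
    have smooth_f := contMDiffAt_of_smul (hℓ p) (hℓ₀ p) (h.smooth p)
    have apply_smul := h.rotation p v
    rw [D.smul_apply (smooth_f.mdifferentiableAt (by simp)) (hℓ p).diffAt, df_eq_zero] at apply_smul
    refine smul_right_injective _ f_ne_zero ?_
    simpa [smul_comm (rot p v)] using apply_smul

end IsRecurrent

end Recurrent

section Comparison

variable {n : ℕ} {N : Type*} [TopologicalSpace N]
  [ChartedSpace (EuclideanSpace ℝ (Fin (n - 1))) N] [IsManifold (𝓡 (n - 1)) ∞ N]
  {D₁ D₂ : Connection (n - 1) N} {ℓ X Y : VField (n - 1) N}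
  {rot : Π p : N, TangentSpace (𝓡 (n - 1)) p →L[ℝ] ℝ} {p : N}

theorem flowCurvature_sub (D₁ D₂ : Connection (n - 1) N) (v w : TangentSpace (𝓡 (n - 1)) p) :
    flowCurvature D₁ rot p v w - flowCurvature D₂ rot p v w =
      rot p (CovariantDerivative.difference D₁ D₂ p w v) := by
  rw [flowCurvature, flowCurvature, D₁.eq_add_difference D₂ (smoothAt_localExtension w).diffAt,
    localExtension_apply_self, map_add]
  ring

namespace IsRecurrent

theorem apply_along_sub_mem_span (h : IsRecurrent D₂ ℓ rot) (hD₁ : D₁.IsSmooth)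
    (hD₂ : D₂.IsSmooth)
    (hC : ∀ (p : N) (u v : TangentSpace (𝓡 (n - 1)) p),
      CovariantDerivative.difference D₁ D₂ p u v ∈ ℝ ∙ ℓ p)
    (hX : SmoothAt X p) (hY : SmoothAt Y p) (u : TangentSpace (𝓡 (n - 1)) p) :
    D₁ (D₁.along X Y) p u - D₂ (D₂.along X Y) p u ∈ ℝ ∙ ℓ p := by
  have smooth₁ := hD₁ p X Y hX hY
  have smooth₂ := hD₂ p X Y hX hY
  have along_sub_mem : ∀ᶠ y in 𝓝 p, (D₁.along X Y - D₂.along X Y) y ∈ ℝ ∙ ℓ y := by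
    filter_upwards [hY.eventually_diffAt] with y diff_Y
    rw [Pi.sub_apply, Connection.along, Connection.along, D₁.eq_add_difference D₂ diff_Y,
      add_sub_cancel_left]
    exact hC y _ _
  have apply_eq : D₂ (D₁.along X Y) p u =
      D₂ (D₂.along X Y) p u + D₂ (D₁.along X Y - D₂.along X Y) p u := by
    rw [← D₂.add_apply smooth₂.diffAt (smooth₁.sub smooth₂).diffAt, add_sub_cancel]
  rw [D₁.eq_add_difference D₂ smooth₁.diffAt, apply_eq, add_assoc, add_sub_cancel_left]
  exact add_mem (h.apply_mem_span (smooth₁.sub smooth₂) along_sub_mem u) (hC p _ _)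

theorem curvatureAt_sub_mem_span (h : IsRecurrent D₂ ℓ rot) (hD₁ : D₁.IsSmooth)
    (hD₂ : D₂.IsSmooth)
    (hC : ∀ (p : N) (u v : TangentSpace (𝓡 (n - 1)) p),
      CovariantDerivative.difference D₁ D₂ p u v ∈ ℝ ∙ ℓ p)
    (u v w : TangentSpace (𝓡 (n - 1)) p) :
    curvatureAt D₁ p u v w - curvatureAt D₂ p u v w ∈ ℝ ∙ ℓ p := by
  have hX := smoothAt_localExtension u
  have hY := smoothAt_localExtension v
  have hZ := smoothAt_localExtension w
  have curvature_eq₁ := curvature_eq_curvatureAt hD₁ hX hY hZ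
  have curvature_eq₂ := curvature_eq_curvatureAt hD₂ hX hY hZ
  simp only [localExtension_apply_self] at curvature_eq₁ curvature_eq₂
  rw [← curvature_eq₁, ← curvature_eq₂, curvature, curvature,
    D₁.eq_add_difference D₂ hZ.diffAt, sub_sub_sub_comm, add_sub_cancel_left, sub_sub_sub_comm]
  exact sub_mem (sub_mem (h.apply_along_sub_mem_span hD₁ hD₂ hC hY hZ _)
    (h.apply_along_sub_mem_span hD₁ hD₂ hC hX hZ _)) (hC p _ _)

end IsRecurrent

end Comparison

section Rigidity

variable {n : ℕ} {N : Type*} [TopologicalSpace N]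
  [ChartedSpace (EuclideanSpace ℝ (Fin (n - 1))) N] [IsManifold (𝓡 (n - 1)) ∞ N]
  {M : Type*} [TopologicalSpace M] [ChartedSpace (EuclideanSpace ℝ (Fin n)) M]
  [IsManifold (𝓡 n) ∞ M]
  {M₁ : Type*} [TopologicalSpace M₁] [ChartedSpace (EuclideanSpace ℝ (Fin n)) M₁]
  [IsManifold (𝓡 n) ∞ M₁]
  {M₂ : Type*} [TopologicalSpace M₂] [ChartedSpace (EuclideanSpace ℝ (Fin n)) M₂]
  [IsManifold (𝓡 n) ∞ M₂]
  {g : LorentzMetric n M} {nabla : Connection n M} {ι : N → M} {D : Connection (n - 1) N}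
  {g₁ : LorentzMetric n M₁} {nabla₁ : Connection n M₁} {ι₁ : N → M₁} {D₁ : Connection (n - 1) N}
  {g₂ : LorentzMetric n M₂} {nabla₂ : Connection n M₂} {ι₂ : N → M₂} {D₂ : Connection (n - 1) N}
  {ℓ ℓ₁ ℓ₂ : VField (n - 1) N} {rot : Π p : N, TangentSpace (𝓡 (n - 1)) p →L[ℝ] ℝ} {f : N → ℝ}
  {p : N}

/-- An immersed null hypersurface with induced connection `D`, and a null field `ℓ` on it with
rotation potential `rot` whose flow preserves `D`. Isolated null surfaces are the main example. -/
structure IsAffineNullSurface (g : LorentzMetric n M) (nabla : Connection n M) (ι : N → M)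
    (D : Connection (n - 1) N) (ℓ : VField (n - 1) N)
    (rot : Π p : N, TangentSpace (𝓡 (n - 1)) p →L[ℝ] ℝ) : Prop where
  immersion : Manifold.IsImmersion (𝓡 (n - 1)) (𝓡 n) ∞ ι
  induced : IsInducedConnection nabla ι D
  null : ∀ p, InNullDirection g ι p (ℓ p)
  recurrent : IsRecurrent D ℓ rot
  affine : IsAffineField D ℓ

theorem IsIsolatedNullSurface.isAffineNullSurface (h : IsIsolatedNullSurface g nabla ι D ℓ)
    (hrot : IsRotationPotential D ℓ rot) : IsAffineNullSurface g nabla ι D ℓ rot :=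
  ⟨h.null.embedding.isImmersion, h.induced, h.flow_null,
    ⟨h.flow_smooth, h.flow_ne_zero, hrot⟩, h.lie_connection⟩

namespace IsAffineNullSurface

theorem torsion_eq_zero (h : IsAffineNullSurface g nabla ι D ℓ rot) (hLC : IsLeviCivita g nabla) :
    D.torsion = 0 :=
  h.induced.torsion_eq_zero h.immersion hLC.torsion_free

theorem mem_span (h : IsAffineNullSurface g nabla ι D ℓ rot)
    {w : TangentSpace (𝓡 (n - 1)) p} (hw : InNullDirection g ι p w) : w ∈ ℝ ∙ ℓ p := by
  obtain ⟨c, rfl⟩ := (h.null p).exists_eq_smul h.immersion (h.recurrent.ne_zero p) hw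
  exact Submodule.smul_mem _ _ (Submodule.mem_span_singleton_self _)

theorem curvatureAt_eq_smul (h : IsAffineNullSurface g nabla ι D ℓ rot)
    (hLC : IsLeviCivita g nabla) {l : TangentSpace (𝓡 (n - 1)) p} (hl : InNullDirection g ι p l)
    (v w : TangentSpace (𝓡 (n - 1)) p) :
    curvatureAt D p l v w = flowCurvature D rot p v w • l :=
  h.recurrent.curvatureAt_eq_flowCurvature_smul h.induced.smooth (h.torsion_eq_zero hLC) h.affine
    (h.mem_span hl) v w

theorem ricci_push (h : IsAffineNullSurface g nabla ι D ℓ rot) (hLC : IsLeviCivita g nabla)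
    (v w : TangentSpace (𝓡 (n - 1)) p) :
    ricci nabla (ι p) (push ι p v) (push ι p w) = ricci D p v w + flowCurvature D rot p w v :=
  h.induced.ricci_push h.immersion hLC (h.null p) (h.recurrent.ne_zero p)
    (h.curvatureAt_eq_smul hLC (h.null p) w v)

theorem ricci_push_flow (h : IsAffineNullSurface g nabla ι D ℓ rot) (hLC : IsLeviCivita g nabla)
    (v : TangentSpace (𝓡 (n - 1)) p) :
    ricci nabla (ι p) (push ι p v) (push ι p (ℓ p)) =
      -mvfderiv (𝓡 (n - 1)) (fun y ↦ rot y (ℓ y)) p v := by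
  have curvatureAt_self : curvatureAt D p (ℓ p) (ℓ p) v = (0 : ℝ) • ℓ p := by
    have : IsAddTorsionFree (TangentSpace (𝓡 (n - 1)) p) := .of_isTorsionFree ℝ _
    rw [zero_smul]
    exact self_eq_neg.1 (curvatureAt_swap _ _ _)
  rw [h.induced.ricci_push h.immersion hLC (h.null p) (h.recurrent.ne_zero p) curvatureAt_self,
    h.recurrent.ricci_apply_flow h.induced.smooth (h.torsion_eq_zero hLC) h.affine, add_zero]

theorem mvfderiv_eq_zero_of_smul (h₁ : IsAffineNullSurface g₁ nabla₁ ι₁ D₁ ℓ rot)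
    (h₂ : IsAffineNullSurface g₂ nabla₂ ι₂ D₂ (f • ℓ) rot)
    (hLC₁ : IsLeviCivita g₁ nabla₁) (hLC₂ : IsLeviCivita g₂ nabla₂)
    (hRic : ∀ u v : TangentSpace (𝓡 (n - 1)) p,
      ricci nabla₁ (ι₁ p) (push ι₁ p u) (push ι₁ p v) =
        ricci nabla₂ (ι₂ p) (push ι₂ p u) (push ι₂ p v))
    (hκ : rot p (ℓ p) ≠ 0) : mvfderiv (𝓡 (n - 1)) f p = 0 := by
  ext v
  have smooth_ℓ := h₁.recurrent.smooth p
  have smooth_f := contMDiffAt_of_smul smooth_ℓ (h₁.recurrent.ne_zero p) (h₂.recurrent.smooth p)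
  have smooth_κ := h₁.recurrent.contMDiffAt_rot h₁.induced.smooth smooth_ℓ
  have gravity_eq : (fun y ↦ rot y ((f • ℓ) y)) = f * fun y ↦ rot y (ℓ y) := by
    ext y
    simp
  have mvfderiv_eq : f p * mvfderiv (𝓡 (n - 1)) (fun y ↦ rot y (ℓ y)) p v =
      mvfderiv (𝓡 (n - 1)) (f * fun y ↦ rot y (ℓ y)) p v := by
    rw [← neg_inj, ← mul_neg, ← h₁.ricci_push_flow hLC₁, ← gravity_eq, ← h₂.ricci_push_flow hLC₂,
      Pi.smul_apply', map_smul, ricci_smul_right hLC₂.smooth, hRic]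
  rw [mvfderiv_mul (smooth_f.mdifferentiableAt (by simp))
    (smooth_κ.mdifferentiableAt (by simp))] at mvfderiv_eq
  simpa [hκ] using mvfderiv_eq

theorem isRecurrent_of_ricci_eq (h₁ : IsAffineNullSurface g₁ nabla₁ ι₁ D₁ ℓ₁ rot)
    (h₂ : IsAffineNullSurface g₂ nabla₂ ι₂ D₂ ℓ₂ rot)
    (hLC₁ : IsLeviCivita g₁ nabla₁) (hLC₂ : IsLeviCivita g₂ nabla₂)
    (hq : inducedForm ι₁ g₁ = inducedForm ι₂ g₂)
    (hRic : ∀ (p : N) (u v : TangentSpace (𝓡 (n - 1)) p),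
      ricci nabla₁ (ι₁ p) (push ι₁ p u) (push ι₁ p v) =
        ricci nabla₂ (ι₂ p) (push ι₂ p u) (push ι₂ p v))
    (hκ : ∀ p, rot p (ℓ₁ p) ≠ 0) : IsRecurrent D₂ ℓ₁ rot := by
  have null_ℓ₂ (p : N) : InNullDirection g₁ ι₁ p (ℓ₂ p) :=
    (h₂.null p).of_inducedForm_eq hq.symm
  choose f hf using fun p ↦
    (h₁.null p).exists_eq_smul h₁.immersion (h₁.recurrent.ne_zero p) (null_ℓ₂ p)
  obtain rfl : ℓ₂ = f • ℓ₁ := funext hf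
  exact h₂.recurrent.of_smul h₁.recurrent.smooth h₁.recurrent.ne_zero
    fun p ↦ h₁.mvfderiv_eq_zero_of_smul h₂ hLC₁ hLC₂ (hRic p) (hκ p)

theorem difference_mem_span (h₁ : IsAffineNullSurface g₁ nabla₁ ι₁ D₁ ℓ₁ rot)
    (h₂ : IsAffineNullSurface g₂ nabla₂ ι₂ D₂ ℓ₂ rot)
    (hLC₁ : IsLeviCivita g₁ nabla₁) (hLC₂ : IsLeviCivita g₂ nabla₂)
    (hq : inducedForm ι₁ g₁ = inducedForm ι₂ g₂) (u v : TangentSpace (𝓡 (n - 1)) p) :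
    CovariantDerivative.difference D₁ D₂ p u v ∈ ℝ ∙ ℓ₁ p :=
  h₁.mem_span fun w ↦ Connection.Preserves.apply_difference_eq_zero (q := inducedForm ι₁ g₁)
    (fun _ _ ↦ g₁.symm _ _ _)
    (h₁.induced.preserves_inducedForm h₁.immersion hLC₁)
    (hq ▸ h₂.induced.preserves_inducedForm h₂.immersion hLC₂)
    (h₁.torsion_eq_zero hLC₁) (h₂.torsion_eq_zero hLC₂) u v w

theorem rot_difference_eq_zero (h₁ : IsAffineNullSurface g₁ nabla₁ ι₁ D₁ ℓ₁ rot)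
    (h₂ : IsAffineNullSurface g₂ nabla₂ ι₂ D₂ ℓ₂ rot)
    (hLC₁ : IsLeviCivita g₁ nabla₁) (hLC₂ : IsLeviCivita g₂ nabla₂)
    (hq : inducedForm ι₁ g₁ = inducedForm ι₂ g₂) (hℓ₁ : IsRecurrent D₂ ℓ₁ rot)
    (hRic : ∀ u v : TangentSpace (𝓡 (n - 1)) p,
      ricci nabla₁ (ι₁ p) (push ι₁ p u) (push ι₁ p v) =
        ricci nabla₂ (ι₂ p) (push ι₂ p u) (push ι₂ p v))
    (u v : TangentSpace (𝓡 (n - 1)) p) :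
    rot p (CovariantDerivative.difference D₁ D₂ p u v) = 0 := by
  have ricci_sub : ricci D₁ p u v - ricci D₂ p u v =
      flowCurvature D₁ rot p u v - flowCurvature D₂ rot p u v :=
    ricci_sub_ricci_of_curvatureAt_sub_mem_span h₁.induced.smooth h₂.induced.smooth
      (h₁.recurrent.ne_zero p)
      (fun w ↦ hℓ₁.curvatureAt_sub_mem_span h₁.induced.smooth h₂.induced.smooth
        (fun _ ↦ h₁.difference_mem_span h₂ hLC₁ hLC₂ hq) w u v)
      (h₁.curvatureAt_eq_smul hLC₁ (h₁.null p) u v)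
      (h₂.curvatureAt_eq_smul hLC₂ ((h₁.null p).of_inducedForm_eq hq) u v)
  have ricci_eq := hRic u v
  rw [h₁.ricci_push hLC₁, h₂.ricci_push hLC₂] at ricci_eq
  have sub_uv := flowCurvature_sub (rot := rot) D₁ D₂ u v
  have sub_vu := flowCurvature_sub (rot := rot) D₁ D₂ v u
  rw [difference_comm_of_torsion_eq_zero (h₁.torsion_eq_zero hLC₁) (h₂.torsion_eq_zero hLC₂)]
    at sub_uv
  linarith

theorem difference_eq_zero (h₁ : IsAffineNullSurface g₁ nabla₁ ι₁ D₁ ℓ₁ rot)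
    (h₂ : IsAffineNullSurface g₂ nabla₂ ι₂ D₂ ℓ₂ rot)
    (hLC₁ : IsLeviCivita g₁ nabla₁) (hLC₂ : IsLeviCivita g₂ nabla₂)
    (hq : inducedForm ι₁ g₁ = inducedForm ι₂ g₂)
    (hRic : ∀ (p : N) (u v : TangentSpace (𝓡 (n - 1)) p),
      ricci nabla₁ (ι₁ p) (push ι₁ p u) (push ι₁ p v) =
        ricci nabla₂ (ι₂ p) (push ι₂ p u) (push ι₂ p v))
    (hκ : ∀ p, rot p (ℓ₁ p) ≠ 0) (u v : TangentSpace (𝓡 (n - 1)) p) :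
    CovariantDerivative.difference D₁ D₂ p u v = 0 := by
  have hℓ₁ := h₁.isRecurrent_of_ricci_eq h₂ hLC₁ hLC₂ hq hRic hκ
  have rot_eq_zero := h₁.rot_difference_eq_zero h₂ hLC₁ hLC₂ hq hℓ₁ (hRic p) u v
  obtain ⟨c, hc⟩ := Submodule.mem_span_singleton.1
    (h₁.difference_mem_span h₂ hLC₁ hLC₂ hq u v)
  rw [← hc, map_smul, smul_eq_mul] at rot_eq_zero
  rw [← hc, (mul_eq_zero.1 rot_eq_zero).resolve_right (hκ p), zero_smul]

end IsAffineNullSurface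

end Rigidity

end NullSurface

end

theorem theorem3_general {n : ℕ}
    {N : Type*} [TopologicalSpace N] [ChartedSpace (EuclideanSpace ℝ (Fin (n - 1))) N]
    [IsManifold (𝓡 (n - 1)) ∞ N]
    {M₁ : Type*} [TopologicalSpace M₁] [ChartedSpace (EuclideanSpace ℝ (Fin n)) M₁]
    [IsManifold (𝓡 n) ∞ M₁]
    {M₂ : Type*} [TopologicalSpace M₂] [ChartedSpace (EuclideanSpace ℝ (Fin n)) M₂]
    [IsManifold (𝓡 n) ∞ M₂]
    {g₁ : NullSurface.LorentzMetric n M₁} {nabla₁ : NullSurface.Connection n M₁}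
    (hLC₁ : NullSurface.IsLeviCivita g₁ nabla₁)
    {g₂ : NullSurface.LorentzMetric n M₂} {nabla₂ : NullSurface.Connection n M₂}
    (hLC₂ : NullSurface.IsLeviCivita g₂ nabla₂)
    {rot : Π p : N, TangentSpace (𝓡 (n - 1)) p →L[ℝ] ℝ}
    {ι₁ : N → M₁} {D₁ : NullSurface.Connection (n - 1) N} {ℓ₁ : NullSurface.VField (n - 1) N}
    (hN₁ : NullSurface.IsAffineNullSurface g₁ nabla₁ ι₁ D₁ ℓ₁ rot)
    (hκ₁ : NullSurface.IsNonExtremal D₁ ℓ₁)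
    {ι₂ : N → M₂} {D₂ : NullSurface.Connection (n - 1) N} {ℓ₂ : NullSurface.VField (n - 1) N}
    (hN₂ : NullSurface.IsAffineNullSurface g₂ nabla₂ ι₂ D₂ ℓ₂ rot)
    (hq : ∀ (p : N) (u v : TangentSpace (𝓡 (n - 1)) p),
      NullSurface.inducedMetric ι₁ g₁ p u v = NullSurface.inducedMetric ι₂ g₂ p u v)
    (hRic : ∀ (p : N) (u v : TangentSpace (𝓡 (n - 1)) p),
      NullSurface.ricci nabla₁ (ι₁ p) (NullSurface.push ι₁ p u) (NullSurface.push ι₁ p v) =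
        NullSurface.ricci nabla₂ (ι₂ p) (NullSurface.push ι₂ p u) (NullSurface.push ι₂ p v))
    (p : N) (Y : NullSurface.VField (n - 1) N) (hY : NullSurface.DiffAt Y p) :
    D₁ Y p = D₂ Y p := by
  have inducedForm_eq : NullSurface.inducedForm ι₁ g₁ = NullSurface.inducedForm ι₂ g₂ :=
    funext fun p ↦ LinearMap.ext₂ (hq p)
  ext v
  rw [D₁.eq_add_difference D₂ hY, hN₁.difference_eq_zero hN₂ hLC₁ hLC₂ inducedForm_eq hRic
    (hN₁.recurrent.rot_apply_ne_zero hκ₁), add_zero]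

theorem theorem3 {n : ℕ} (hn : 2 < n)
    {N : Type*} [TopologicalSpace N] [ChartedSpace (EuclideanSpace ℝ (Fin (n - 1))) N]
    [IsManifold (𝓡 (n - 1)) ∞ N]
    {M₁ : Type*} [TopologicalSpace M₁] [ChartedSpace (EuclideanSpace ℝ (Fin n)) M₁]
    [IsManifold (𝓡 n) ∞ M₁]
    {M₂ : Type*} [TopologicalSpace M₂] [ChartedSpace (EuclideanSpace ℝ (Fin n)) M₂]
    [IsManifold (𝓡 n) ∞ M₂]
    (g₁ : NullSurface.LorentzMetric n M₁) (nabla₁ : NullSurface.Connection n M₁)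
    (hLC₁ : NullSurface.IsLeviCivita g₁ nabla₁)
    (g₂ : NullSurface.LorentzMetric n M₂) (nabla₂ : NullSurface.Connection n M₂)
    (hLC₂ : NullSurface.IsLeviCivita g₂ nabla₂)
    (ι₁ : N → M₁) (D₁ : NullSurface.Connection (n - 1) N) (ℓ₁ : NullSurface.VField (n - 1) N)
    (hN₁ : NullSurface.IsIsolatedNullSurface g₁ nabla₁ ι₁ D₁ ℓ₁)
    (hκ₁ : NullSurface.IsNonExtremal D₁ ℓ₁)
    (ι₂ : N → M₂) (D₂ : NullSurface.Connection (n - 1) N) (ℓ₂ : NullSurface.VField (n - 1) N)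
    (hN₂ : NullSurface.IsIsolatedNullSurface g₂ nabla₂ ι₂ D₂ ℓ₂)
    (hκ₂ : NullSurface.IsNonExtremal D₂ ℓ₂)
    (Λ : ℝ)
    (hE₁ : NullSurface.VacuumEinsteinOn g₁ nabla₁ Λ (Set.range ι₁))
    (hE₂ : NullSurface.VacuumEinsteinOn g₂ nabla₂ Λ (Set.range ι₂))
    (hq : ∀ (p : N) (u v : TangentSpace (𝓡 (n - 1)) p),
      NullSurface.inducedMetric ι₁ g₁ p u v = NullSurface.inducedMetric ι₂ g₂ p u v)
    (rot : Π p : N, TangentSpace (𝓡 (n - 1)) p →L[ℝ] ℝ)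
    (hrot₁ : NullSurface.IsRotationPotential D₁ ℓ₁ rot)
    (hrot₂ : NullSurface.IsRotationPotential D₂ ℓ₂ rot) :
    ∀ (p : N) (Y : NullSurface.VField (n - 1) N), NullSurface.DiffAt Y p →
      D₁ Y p = D₂ Y p := by
  refine theorem3_general hLC₁ hLC₂ (hN₁.isAffineNullSurface hrot₁) hκ₁
    (hN₂.isAffineNullSurface hrot₂) hq fun p u v ↦ ?_
  rw [hE₁.ricci_eq hn ⟨p, rfl⟩, hE₂.ricci_eq hn ⟨p, rfl⟩]
  exact congrArg _ (hq p u v)
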